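/- Let $W,V:\mathbb{R}\to\mathbb{R}$ be strictly increasing, $W$ càdlàg and $V$ càglàd, with $W(x+1)-W(x)=W(1)-W(0)$ and $V(x+1)-V(x)=V(1)-V(0)$ for all $x$, both continuous and equal to $0$ at $0$. Let $L^2_W(\mathbb{T})$, $L^2_V(\mathbb{T})$ be the real $L^2$ spaces of the measures induced by $W$ and $V$ on $\mathbb{T}=\mathbb{R}/\mathbb{Z}$. For functions on $\mathbb{T}$ put $$D_W^-f(x)=\lim_{h\to0^-}\frac{f(x+h)-f(x)}{W(x+h)-W(x)},\qquad D_V^+g(x)=\lim_{h\to0^+}\frac{g(x+h)-g(x)}{V(x+h)-V(x)},$$ and let $\mathfrak{D}_{W,V}(\mathbb{T})$ be the set of càdlàg $f:\mathbb{T}\to\mathbb{R}$ such that $D_W^-f$ exists everywhere and is càglàd, and $D_V^+D_W^-f$ exists everywhere and is càdlàg. Put $\|f\|_{1,2}^2=\langle (I-D_V^+D_W^-)f,f\rangle_V$ on $\mathfrak{D}_{W,V}(\mathbb{T})$. Let $H_{W,V}(\mathbb{T})$ be the energetic space of $I-D_V^+D_W^-$, that is, the set of $f\in L^2_V(\mathbb{T})$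 that are $L^2_V$-limits of sequences in $\mathfrak{D}_{W,V}(\mathbb{T})$ which are Cauchy for $\|\cdot\|_{1,2}$. For $f\in H_{W,V}(\mathbb{T})$ let $D_W^-f$ be the unique $F\in L^2_W(\mathbb{T})$ with $\int_{\mathbb{T}}F\,dW=0$ such that, for some constant $c$, $f(x)=c+\int_{(0,x]}F\,dW$ for $V$-almost every $x\in(0,1]$. Let $\mathcal{A}$ be the Friedrichs extension of $I-D_V^+D_W^-:\mathfrak{D}_{W,V}(\mathbb{T})\subset L^2_V(\mathbb{T})\to L^2_V(\mathbb{T})$, and $\Delta_{W,V}=I-\mathcal{A}$. There is a complete orthonormal system $(\nu_i)_{i\ge0}$ of $L^2_V(\mathbb{T})$ consisting of eigenvectors, $-\Delta_{W,V}\nu_i=\lambda_i\nu_i$, enumerated so that $\lambda_0=0$. For every such system, $\lambda_i>0$ for all $i\ge1$, and: 1. $$H_{W,V}(\mathbb{T})=\Big\{f\in L^2_V(\mathbb{T}):\ f=\alpha_0+\sum_{i=1}^\infty\alpha_i\nu_i \text{ in } L^2_V(\mathbb{T})\text{ for some real numbers }(\alpha_i)_{i\ge0}\text{ with }\sum_{i=1}^\infty\lambda_i\alpha_i^2<\infty\Big\},$$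 where $\alpha_0$ stands for a constant function. 2. The functions $\frac{1}{\sqrt{\lambda_i}}D_W^-\nu_i$, $i\ge1$, are orthonormal in $L^2_W(\mathbb{T})$, and their closed linear span is the derivative space $\{D_W^-f: f\in H_{W,V}(\mathbb{T})\}$. -/

import Mathlib

open MeasureTheory Set Filter Topology

noncomputable section

/-- Right-continuous with left limits. -/
def IsCadlag (f : ℝ → ℝ) : Prop :=
  ∀ x, ContinuousWithinAt f (Ici x) x ∧ ∃ l, Tendsto f (𝓝[<] x) (𝓝 l)

/-- Left-continuous with right limits. -/
def IsCaglad (f : ℝ → ℝ) : Prop :=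
  ∀ x, ContinuousWithinAt f (Iic x) x ∧ ∃ l, Tendsto f (𝓝[>] x) (𝓝 l)

/-- A pair of strictly increasing functions with periodic increments, `W` càdlàg and `V` càglàd,
both continuous and equal to zero at the origin. -/
structure WeightPair where
  W : ℝ → ℝ
  V : ℝ → ℝ
  strictMono_W : StrictMono W
  strictMono_V : StrictMono V
  cadlag_W : IsCadlag W
  caglad_V : IsCaglad V
  periodic_W : ∀ x, W (x + 1) - W x = W 1 - W 0
  periodic_V : ∀ x, V (x + 1) - V x = V 1 - V 0
  W_zero : W 0 = 0
  V_zero : V 0 = 0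
  continuousAt_W : ContinuousAt W 0
  continuousAt_V : ContinuousAt V 0

namespace WeightPair

/-! Functions on the circle `𝕋 = ℝ / ℤ` are represented by `1`-periodic functions on `ℝ`, and
measures on `𝕋` by their copies on the fundamental domain `(0, 1]`. -/

/-- The measure on `𝕋` induced by `W`: it gives `(a, b] ⊆ (0, 1]` the mass `W b - W a`. -/
def μW (p : WeightPair) : Measure ℝ :=
  p.strictMono_W.monotone.stieltjesFunction.measure.restrict (Ioc 0 1)

/-- The measure on `𝕋` induced by `V`: `Monotone.stieltjesFunction` is the right-continuous
modification of `V`, so `[a, b) ⊆ (0, 1]` gets the mass `V b - V a`. -/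
def μV (p : WeightPair) : Measure ℝ :=
  p.strictMono_V.monotone.stieltjesFunction.measure.restrict (Ioc 0 1)

instance (p : WeightPair) : IsFiniteMeasure p.μW :=
  isFiniteMeasure_restrict.2 (measure_Ioc_lt_top).ne

instance (p : WeightPair) : IsFiniteMeasure p.μV :=
  isFiniteMeasure_restrict.2 (measure_Ioc_lt_top).ne

/-- `L²_W(𝕋)`. -/
abbrev L2W (p : WeightPair) : Type := Lp ℝ 2 p.μW

/-- `L²_V(𝕋)`. -/
abbrev L2V (p : WeightPair) : Type := Lp ℝ 2 p.μV

end WeightPair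

/-- `f` is left differentiable with respect to `W` at every point. -/
def LeftDifferentiable (W f : ℝ → ℝ) : Prop :=
  ∀ x, ∃ l, Tendsto (fun y => (f y - f x) / (W y - W x)) (𝓝[<] x) (𝓝 l)

/-- `f` is right differentiable with respect to `V` at every point. -/
def RightDifferentiable (V f : ℝ → ℝ) : Prop :=
  ∀ x, ∃ l, Tendsto (fun y => (f y - f x) / (V y - V x)) (𝓝[>] x) (𝓝 l)

/-- The pointwise left derivative `D⁻_W f`. -/
def leftD (W f : ℝ → ℝ) (x : ℝ) : ℝ :=
  limUnder (𝓝[<] x) (fun y => (f y - f x) / (W y - W x))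

/-- The pointwise right derivative `D⁺_V f`. -/
def rightD (V f : ℝ → ℝ) (x : ℝ) : ℝ :=
  limUnder (𝓝[>] x) (fun y => (f y - f x) / (V y - V x))

namespace WeightPair

/-- The domain `𝔇_{W,V}(𝕋)` of the classical operator `D⁺_V D⁻_W`. -/
def strongDomain (p : WeightPair) : Set (ℝ → ℝ) :=
  {f | Function.Periodic f 1 ∧ IsCadlag f ∧ LeftDifferentiable p.W f ∧
    IsCaglad (leftD p.W f) ∧ RightDifferentiable p.V (leftD p.W f) ∧
    IsCadlag (rightD p.V (leftD p.W f))}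

/-- The energetic form `⟨(I - D⁺_V D⁻_W) f, g⟩_V` on `𝔇_{W,V}(𝕋)`. -/
def energyForm (p : WeightPair) (f g : ℝ → ℝ) : ℝ :=
  ∫ x, (f x - rightD p.V (leftD p.W f) x) * g x ∂p.μV

/-- The energetic norm `‖f‖_{1,2}` on `𝔇_{W,V}(𝕋)`. -/
def energyNorm (p : WeightPair) (f : ℝ → ℝ) : ℝ :=
  √(p.energyForm f f)

/-- `(fₙ)` is an admissible sequence for `f ∈ L²_V(𝕋)`: a sequence in `𝔇_{W,V}(𝕋)` that converges
to `f` in `L²_V(𝕋)` and is Cauchy in the energetic norm. -/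
def Admissible (p : WeightPair) (fn : ℕ → ℝ → ℝ) (f : p.L2V) : Prop :=
  (∀ n, fn n ∈ p.strongDomain) ∧
  Tendsto (fun n => eLpNorm (fun x => fn n x - f x) 2 p.μV) atTop (𝓝 0) ∧
  ∀ ε > 0, ∃ N, ∀ m ≥ N, ∀ n ≥ N, p.energyNorm (fun x => fn m x - fn n x) < ε

/-- The Sobolev space `H_{W,V}(𝕋)`: the energetic space of `I - D⁺_V D⁻_W`. -/
def sobolev (p : WeightPair) : Set p.L2V :=
  {f | ∃ fn, p.Admissible fn f}

/-- `F` is the derivative `D⁻_W f` of the class `f`: `F` has `W`-mean zero and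
`f(x) = c + ∫_{(0,x]} F dW` for `V`-almost every `x` and some constant `c`. -/
def IsSobolevDeriv (p : WeightPair) (f : p.L2V) (F : p.L2W) : Prop :=
  ∫ s, F s ∂p.μW = 0 ∧ ∃ c : ℝ, ∀ᵐ x ∂p.μV, f x = c + ∫ s in Ioc 0 x, F s ∂p.μW

open Classical in
/-- The derivative `D⁻_W f ∈ L²_W(𝕋)` of `f ∈ H_{W,V}(𝕋)`. -/
def sobolevDeriv (p : WeightPair) (f : p.L2V) : p.L2W :=
  if h : ∃ F, p.IsSobolevDeriv f F then h.choose else 0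

/-- The derivative space `{D⁻_W f : f ∈ H_{W,V}(𝕋)}`. -/
def derivSpace (p : WeightPair) : Set p.L2W :=
  {F | ∃ f ∈ p.sobolev, p.IsSobolevDeriv f F}

/-- `𝒜 u = h`, where `𝒜` is the Friedrichs extension of `I - D⁺_V D⁻_W`: `u` lies in the energetic
space, and `(u | v)_E = ⟨h, v⟩_V` for all `v` in it. Here `(u | v)_E` is the energetic inner product,
the limit of `⟨(I - D⁺_V D⁻_W) uₙ, vₙ⟩_V` along admissible sequences for `u` and `v`. -/
def IsFriedrichs (p : WeightPair) (u h : p.L2V) : Prop :=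
  u ∈ p.sobolev ∧ ∀ v ∈ p.sobolev, ∀ un vn, p.Admissible un u → p.Admissible vn v →
    Tendsto (fun n => p.energyForm (un n) (vn n)) atTop (𝓝 (inner ℝ h v))

/-- `Δ_{W,V} u = k`, where `Δ_{W,V} = I - 𝒜`. -/
def IsLaplacian (p : WeightPair) (u k : p.L2V) : Prop :=
  p.IsFriedrichs u (u - k)

/-- `(ν_i)_{i ≥ 0}` is a complete orthonormal system of `L²_V(𝕋)` with
`-Δ_{W,V} ν_i = λ_i ν_i` for all `i`, enumerated so that `λ_0 = 0`. -/
structure IsEigensystem (p : WeightPair) (ν : ℕ → p.L2V) (lam : ℕ → ℝ) : Prop where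
  orthonormal : Orthonormal ℝ ν
  complete : (Submodule.span ℝ (range ν)).topologicalClosure = ⊤
  eigen : ∀ i, p.IsLaplacian (ν i) (-(lam i • ν i))
  lam_zero : lam 0 = 0

end WeightPair

end

/-!
The circle problem is reduced to the spectral theorem for one compact operator.

Let `T F (x) = ∫_{(0, x]} F dW`, a map `L²_W(𝕋) → L²_V(𝕋)` whose adjoint is
`u ↦ ∫_{[s, 1]} u dV` by Fubini, and let `J = P T P` (`WeightPair.primitive`), where `P` denotes the
projection off the constants on either side. As an integral operator with square integrable kernel
`J` is compact (`isCompactOperator_kernelOperator`). Since `W` and `V` are strictly increasing,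
their measures charge every interval, and the one-sided continuity of primitives shows that the
kernels of `J` and `J†` consist of the constants only (`exists_smul_eq_of_primitive_eq_zero`,
`exists_smul_eq_of_adjoint_primitive_eq_zero`).

A mean value argument for one-sided Stieltjes derivatives (`eq_of_leftQuotient_tendsto_zero`) gives
the Newton-Leibniz formula for `D⁻_W` and `D⁺_V`. Hence a classical function is a primitive of
`D⁻_W f`, integration by parts reads `D⁻_W f = -J† (D⁺_V D⁻_W f)`, and the energy form is
`⟨f, g⟩_V + ⟨D⁻_W f, D⁻_W g⟩_W` (`energyForm_eq`). Moreover the derivatives of classical functions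
are dense among the functions of `W`-mean zero: if `K` is orthogonal to all of them, then testing
with the càdlàg function `J K` gives `J K = 0`, so `K` is constant
(`mem_closure_adjoint_cadlagClasses`). Therefore the energetic space is `{J F + c}` with `F` of mean
zero, where `F` is the derivative, and the derivative space is the complement of the constants
(`mem_sobolev_iff`, `derivSpace_eq`); the equation `-Δ u = λ u` becomes
`⟨D u, D v⟩_W = λ ⟨u, v⟩_V` for all `v` in the energetic space (`isLaplacian_iff`).

What remains is Hilbert space theory of the pair `(J, constants)`. The eigenvectors of the compact
symmetric operator `J J†` are those of `-Δ`, with inverse eigenvalues (`exists_weakEigen_basis`).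
For any eigensystem the vectors `λᵢ^{-1/2} D νᵢ` are orthonormal, `J D νᵢ = νᵢ` for `i ≥ 1`, and both
descriptions follow by comparing coefficients (`exists_isWeakDeriv_iff`,
`closure_span_normalized_deriv`).
-/

noncomputable section

/-! ### Compact symmetric operators -/

section Abstract

variable {X Y : Type*} [NormedAddCommGroup X] [InnerProductSpace ℝ X]
  [NormedAddCommGroup Y] [InnerProductSpace ℝ Y]

theorem Orthonormal.countable_index [TopologicalSpace.SeparableSpace Y] {ι : Type*} {v : ι → Y}
    (hv : Orthonormal ℝ v) : Countable ι := by
  have hd : Pairwise fun i j =>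
      Disjoint (Metric.ball (v i) (1 / 2)) (Metric.ball (v j) (1 / 2)) := by
    intro i j hij
    refine Metric.ball_disjoint_ball ?_
    have h : dist (v i) (v j) ^ 2 = 2 := by
      rw [dist_eq_norm, @norm_sub_sq ℝ, hv.1 i, hv.1 j, hv.2 hij]
      norm_num
    nlinarith [dist_nonneg (x := v i) (y := v j)]
  have := Set.PairwiseDisjoint.countable_of_isOpen (s := fun i => Metric.ball (v i) (1 / 2))
    (a := (Set.univ : Set ι)) (fun i _ j _ hij => hd hij) (fun i _ => Metric.isOpen_ball)
    (fun i _ => Metric.nonempty_ball.2 (by norm_num))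
  exact Set.countable_univ_iff.1 this

/-- A compact symmetric operator with nontrivial kernel has a complete orthonormal sequence of
eigenvectors that starts with an element of the kernel. -/
theorem exists_orthonormal_eigenvectors [CompleteSpace Y] [TopologicalSpace.SeparableSpace Y]
    (hinf : ¬ FiniteDimensional ℝ Y) {S : Y →L[ℝ] Y} (hS : IsCompactOperator S)
    (hsymm : S.IsSymmetric) (hker : ∃ u ≠ 0, S u = 0) :
    ∃ (ν : ℕ → Y) (μ : ℕ → ℝ), Orthonormal ℝ ν ∧
      (Submodule.span ℝ (range ν)).topologicalClosure = ⊤ ∧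
      (∀ i, S (ν i) = μ i • ν i) ∧ μ 0 = 0 := by
  have hcl : ∀ μ : ℝ, IsClosed (Module.End.eigenspace (S : Y →ₗ[ℝ] Y) μ : Set Y) := by
    intro μ
    have : (Module.End.eigenspace (S : Y →ₗ[ℝ] Y) μ : Set Y) = {u | S u = μ • u} := by
      ext u; simp
    rw [this]
    exact isClosed_eq S.continuous (continuous_const_smul μ)
  have hcpl : ∀ μ : ℝ, CompleteSpace (Module.End.eigenspace (S : Y →ₗ[ℝ] Y) μ) :=
    fun μ => (hcl μ).completeSpace_coe
  -- The union of orthonormal bases of the eigenspaces, indexed by a countably infinite type.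
  choose w b hb using fun μ : ℝ =>
    exists_hilbertBasis ℝ (Module.End.eigenspace (S : Y →ₗ[ℝ] Y) μ)
  let v : (Σ μ : ℝ, w μ) → Y := fun a => (b a.1 a.2 : Y)
  have hv : Orthonormal ℝ v :=
    hsymm.orthogonalFamily_eigenspaces.orthonormal_sigma_orthonormal
      (v_family := fun μ => ⇑(b μ)) (fun μ => (b μ).orthonormal)
  have hdense : (Submodule.span ℝ (range v)).topologicalClosure = ⊤ := by
    rw [Submodule.topologicalClosure_eq_top_iff, ← le_bot_iff,
      ← ContinuousLinearMap.orthogonalComplement_iSup_eigenspaces_eq_bot hS hsymm]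
    rw [← Submodule.orthogonal_closure (K := Submodule.span ℝ (range v))]
    refine Submodule.orthogonal_le (iSup_le fun μ y hy => ?_)
    have hsum := ((b μ).hasSum_repr ⟨y, hy⟩).mapL (Submodule.subtypeL _)
    refine mem_closure_of_tendsto hsum (Eventually.of_forall fun s => ?_)
    refine Submodule.sum_mem _ fun i _ => ?_
    rw [map_smul]
    exact Submodule.smul_mem _ _ (Submodule.subset_span ⟨⟨μ, i⟩, rfl⟩)
  have : Countable (Σ μ : ℝ, w μ) := hv.countable_index
  have : Infinite (Σ μ : ℝ, w μ) := by
    by_contra hfin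
    rw [not_infinite_iff_finite] at hfin
    have hfd : FiniteDimensional ℝ (Submodule.span ℝ (range v)) :=
      FiniteDimensional.span_of_finite ℝ (Set.finite_range v)
    rw [(Submodule.closed_of_finiteDimensional _).submodule_topologicalClosure_eq] at hdense
    rw [hdense] at hfd
    exact hinf (Module.finite_def.2 (Module.Finite.iff_fg.1 hfd))
  have h0 : Nonempty (w 0) := by
    by_contra hne
    rw [not_nonempty_iff] at hne
    obtain ⟨u, hu, hSu⟩ := hker
    have hmem : u ∈ Module.End.eigenspace (S : Y →ₗ[ℝ] Y) 0 := by
      simp [hSu]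
    have hs := (b 0).hasSum_repr ⟨u, hmem⟩
    have := hs.unique hasSum_empty
    exact hu (congrArg Subtype.val this)
  obtain ⟨i₀⟩ := h0
  obtain ⟨hden⟩ := nonempty_denumerable (Σ μ : ℝ, w μ)
  classical
  let e₀ : ℕ ≃ (Σ μ : ℝ, w μ) := (Denumerable.eqv _).symm
  -- Enumerate so that a vector of the kernel comes first.
  let e : ℕ ≃ (Σ μ : ℝ, w μ) := e₀.trans (Equiv.swap (e₀ 0) ⟨0, i₀⟩)
  have he : e 0 = ⟨0, i₀⟩ := by simp [e]
  refine ⟨v ∘ e, fun i => (e i).1, hv.comp _ e.injective, ?_, fun i => ?_, ?_⟩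
  · rw [EquivLike.range_comp]; exact hdense
  · exact Module.End.mem_eigenspace_iff.1 (b (e i).1 (e i).2).2
  · simp only [he]

/-! ### Weak derivatives in Hilbert space -/

/-- For an operator `J : X → Y` and distinguished vectors `a : X`, `b : Y` (the constants), `F` is
the weak derivative of `f` if `F ⟂ a` and `f` is the primitive `J F` up to a multiple of `b`. -/
def IsWeakDeriv (J : X →L[ℝ] Y) (a : X) (b : Y) (f : Y) (F : X) : Prop :=
  inner ℝ a F = 0 ∧ ∃ c : ℝ, f = J F + c • b

/-- `u` is a weak eigenvector: the energy form `⟨F, G⟩` of the weak derivatives of `u` and of a test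
vector `v` equals `l * ⟨u, v⟩`. -/
def IsWeakEigen (J : X →L[ℝ] Y) (a : X) (b : Y) (u : Y) (l : ℝ) : Prop :=
  (∃ F, IsWeakDeriv J a b u F) ∧ ∀ F v G, IsWeakDeriv J a b u F → IsWeakDeriv J a b v G →
    inner ℝ F G = l * inner ℝ u v

variable {J : X →L[ℝ] Y} {a : X} {b : Y}

theorem eq_zero_of_apply_eq_zero (hJ : ∀ F, J F = 0 → ∃ c : ℝ, F = c • a) {F : X}
    (hF : inner ℝ a F = 0) (h : J F = 0) : F = 0 := by
  obtain ⟨c, rfl⟩ := hJ F h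
  rw [inner_smul_right, real_inner_self_eq_norm_sq] at hF
  rcases mul_eq_zero.1 hF with h | h
  · simp [h]
  · simp [norm_eq_zero.1 (pow_eq_zero_iff two_ne_zero |>.1 h)]

variable {ν : ℕ → Y} {lam : ℕ → ℝ} {F : ℕ → X}

/-- Weak eigenvectors for the eigenvalue `0` are multiples of `b`. -/
theorem exists_smul_eq_of_weakEigen_zero (hν : Orthonormal ℝ ν)
    (hF : ∀ i, IsWeakDeriv J a b (ν i) (F i)) (heig : ∀ i, IsWeakEigen J a b (ν i) (lam i))
    (i : ℕ) (hi : lam i = 0) : ∃ c : ℝ, c ≠ 0 ∧ ν i = c • b := by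
  have h := (heig i).2 _ _ _ (hF i) (hF i)
  rw [hi, zero_mul] at h
  have h0 : F i = 0 := inner_self_eq_zero.1 h
  obtain ⟨-, c, hc⟩ := hF i
  rw [h0, map_zero, zero_add] at hc
  refine ⟨c, ?_, hc⟩
  rintro rfl
  exact hν.ne_zero i (by rw [hc, zero_smul])

theorem inner_eq_zero_of_weakEigen (hν : Orthonormal ℝ ν)
    (hF : ∀ i, IsWeakDeriv J a b (ν i) (F i)) (heig : ∀ i, IsWeakEigen J a b (ν i) (lam i))
    (h0 : lam 0 = 0) (i : ℕ) : inner ℝ (ν (i + 1)) b = 0 := by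
  obtain ⟨c, hc, h⟩ := exists_smul_eq_of_weakEigen_zero hν hF heig 0 h0
  have : inner ℝ (ν (i + 1)) (ν 0) = 0 := hν.2 (Nat.succ_ne_zero i)
  rw [h, inner_smul_right] at this
  exact (mul_eq_zero.1 this).resolve_left hc

theorem weakEigenvalue_pos (hν : Orthonormal ℝ ν)
    (hF : ∀ i, IsWeakDeriv J a b (ν i) (F i)) (heig : ∀ i, IsWeakEigen J a b (ν i) (lam i))
    (h0 : lam 0 = 0) (i : ℕ) : 0 < lam (i + 1) := by
  have h := (heig (i + 1)).2 _ _ _ (hF (i + 1)) (hF (i + 1))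
  rw [real_inner_self_eq_norm_sq, real_inner_self_eq_norm_sq, hν.1] at h
  refine lt_of_le_of_ne (by nlinarith [sq_nonneg ‖F (i + 1)‖]) fun hi => ?_
  obtain ⟨c, hc, hcb⟩ := exists_smul_eq_of_weakEigen_zero hν hF heig (i + 1) hi.symm
  have h1 := inner_eq_zero_of_weakEigen hν hF heig h0 i
  have h2 : inner ℝ (ν (i + 1)) (ν (i + 1)) = 0 := by
    nth_rewrite 2 [hcb]
    rw [inner_smul_right, h1, mul_zero]
  exact hν.ne_zero (i + 1) (inner_self_eq_zero.1 h2)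

/-- The energy form of two eigenvectors is the eigenvalue times their inner product, so the weak
derivatives of an orthonormal eigensystem are orthogonal with squared norms the eigenvalues. -/
theorem orthonormal_normalized_deriv (hν : Orthonormal ℝ ν)
    (hF : ∀ i, IsWeakDeriv J a b (ν i) (F i)) (heig : ∀ i, IsWeakEigen J a b (ν i) (lam i))
    (h0 : lam 0 = 0) : Orthonormal ℝ (fun i => (√(lam (i + 1)))⁻¹ • F (i + 1)) := by
  classical
  rw [orthonormal_iff_ite]
  intro i j
  have hi := weakEigenvalue_pos hν hF heig h0 i
  rw [real_inner_smul_left, inner_smul_right, (heig (i + 1)).2 _ _ _ (hF _) (hF _),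
    orthonormal_iff_ite.1 hν]
  by_cases hij : i = j
  · subst hij
    have hs : √(lam (i + 1)) ≠ 0 := (Real.sqrt_pos.2 hi).ne'
    have := Real.mul_self_sqrt hi.le
    simp only [if_true]
    field_simp
    rw [sq, this]
  · simp [hij]

variable [CompleteSpace X] [CompleteSpace Y]

theorem inner_apply_of_adjoint_eq_zero (hb : J.adjoint b = 0) (F : X) : inner ℝ b (J F) = 0 := by
  rw [← ContinuousLinearMap.adjoint_inner_left, hb, inner_zero_left]

/-- The weak derivative is unique: primitives `J F` are orthogonal to `b`, so the additive constants
agree, and `J` is injective on the complement of `a`. -/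
theorem IsWeakDeriv.unique (hJ : ∀ F, J F = 0 → ∃ c : ℝ, F = c • a) (hb : J.adjoint b = 0)
    {f : Y} {F G : X} (hF : IsWeakDeriv J a b f F) (hG : IsWeakDeriv J a b f G) : F = G := by
  obtain ⟨hF, c, h1⟩ := hF
  obtain ⟨hG, d, h2⟩ := hG
  refine sub_eq_zero.1 (eq_zero_of_apply_eq_zero hJ (by rw [inner_sub_right, hF, hG, sub_zero]) ?_)
  have h3 : J (F - G) = (d - c) • b := by
    rw [map_sub, sub_smul, sub_eq_sub_iff_add_eq_add, ← h1, h2, add_comm]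
  have h4 := inner_apply_of_adjoint_eq_zero hb (F - G)
  rw [h3, inner_smul_right, real_inner_self_eq_norm_sq] at h4
  rw [h3]
  rcases mul_eq_zero.1 h4 with h | h
  · simp [h]
  · simp [norm_eq_zero.1 (pow_eq_zero_iff two_ne_zero |>.1 h)]

/-- The eigenvectors of `J J†` form a complete system of weak eigenvectors; an eigenvalue `μ ≠ 0` of
`J J†` corresponds to the weak eigenvalue `μ⁻¹`, and its kernel, spanned by `b`, to `0`. -/
theorem exists_weakEigen_basis [TopologicalSpace.SeparableSpace Y]
    (hinf : ¬ FiniteDimensional ℝ Y) (hcomp : IsCompactOperator J) (hb0 : b ≠ 0)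
    (ha : J a = 0) (hJ : ∀ F, J F = 0 → ∃ c : ℝ, F = c • a) (hb : J.adjoint b = 0)
    (hJ' : ∀ u, J.adjoint u = 0 → ∃ c : ℝ, u = c • b) :
    ∃ (ν : ℕ → Y) (lam : ℕ → ℝ), Orthonormal ℝ ν ∧
      (Submodule.span ℝ (range ν)).topologicalClosure = ⊤ ∧
      (∀ i, IsWeakEigen J a b (ν i) (lam i)) ∧ lam 0 = 0 := by
  have hSc : IsCompactOperator (J ∘L J.adjoint) := by
    rw [ContinuousLinearMap.coe_comp]
    exact hcomp.comp_clm J.adjoint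
  have hSs : (J ∘L J.adjoint).IsSymmetric := by
    intro x y
    change inner ℝ (J (J.adjoint x)) y = inner ℝ x (J (J.adjoint y))
    rw [← ContinuousLinearMap.adjoint_inner_left, ← ContinuousLinearMap.adjoint_inner_right]
  obtain ⟨ν, μ, hν, hd, hS, h0⟩ := exists_orthonormal_eigenvectors hinf hSc hSs
    ⟨b, hb0, by simp [hb]⟩
  refine ⟨ν, fun i => (μ i)⁻¹, hν, hd, fun i => ?_, by simp [h0]⟩
  -- The weak derivative is `μ⁻¹ J† ν`; for `μ = 0` the convention `0⁻¹ = 0` gives the right value.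
  have hSi : J (J.adjoint (ν i)) = μ i • ν i := hS i
  have hD : IsWeakDeriv J a b (ν i) ((μ i)⁻¹ • J.adjoint (ν i)) := by
    refine ⟨by rw [inner_smul_right, ContinuousLinearMap.adjoint_inner_right, ha]; simp, ?_⟩
    by_cases hμ : μ i = 0
    · have : J.adjoint (ν i) = 0 := by
        rw [← inner_self_eq_zero (𝕜 := ℝ), ContinuousLinearMap.adjoint_inner_left, hSi, hμ]
        simp
      obtain ⟨c, hc⟩ := hJ' _ this
      exact ⟨c, by simp only [hμ, inv_zero, zero_smul, map_zero, zero_add]; exact hc⟩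
    · exact ⟨0, by rw [map_smul, hSi, smul_smul, inv_mul_cancel₀ hμ]; simp⟩
  refine ⟨⟨_, hD⟩, fun F v G hF hG => ?_⟩
  rw [hF.unique hJ hb hD]
  obtain ⟨-, c, rfl⟩ := hG
  rw [inner_smul_left, ContinuousLinearMap.adjoint_inner_left, inner_add_right, inner_smul_right]
  by_cases hμ : μ i = 0
  · simp [hμ]
  · have : inner ℝ (ν i) b = 0 := by
      have h := inner_apply_of_adjoint_eq_zero hb (J.adjoint (ν i))
      rw [hSi, inner_smul_right, real_inner_comm] at h
      exact (mul_eq_zero.1 h).resolve_left hμ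
    rw [this]; simp

theorem apply_deriv_eq (hb : J.adjoint b = 0) (hν : Orthonormal ℝ ν)
    (hF : ∀ i, IsWeakDeriv J a b (ν i) (F i)) (heig : ∀ i, IsWeakEigen J a b (ν i) (lam i))
    (h0 : lam 0 = 0) (i : ℕ) : J (F (i + 1)) = ν (i + 1) := by
  obtain ⟨-, c, hc⟩ := hF (i + 1)
  have h1 := inner_eq_zero_of_weakEigen hν hF heig h0 i
  have h2 := inner_apply_of_adjoint_eq_zero hb (F (i + 1))
  rw [real_inner_comm] at h2
  nth_rewrite 1 [hc] at h1
  rw [inner_add_left, h2, zero_add, real_inner_smul_left] at h1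
  have : c • b = 0 := by
    rcases mul_eq_zero.1 h1 with h | h
    · rw [h, zero_smul]
    · rw [inner_self_eq_zero.1 h, smul_zero]
  rw [hc, this, add_zero]

/-- The weak derivatives of a complete eigensystem span the orthogonal complement of `a`. -/
theorem closure_span_normalized_deriv (hJ : ∀ F, J F = 0 → ∃ c : ℝ, F = c • a)
    (hb : J.adjoint b = 0)
    (hν : Orthonormal ℝ ν) (hd : (Submodule.span ℝ (range ν)).topologicalClosure = ⊤)
    (hF : ∀ i, IsWeakDeriv J a b (ν i) (F i)) (heig : ∀ i, IsWeakEigen J a b (ν i) (lam i))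
    (h0 : lam 0 = 0) :
    (Submodule.span ℝ (range fun i => (√(lam (i + 1)))⁻¹ • F (i + 1))).topologicalClosure =
      (ℝ ∙ a)ᗮ := by
  set K := Submodule.span ℝ (range fun i => (√(lam (i + 1)))⁻¹ • F (i + 1)) with hK
  have hle : K ≤ (ℝ ∙ a)ᗮ := by
    rw [hK, Submodule.span_le]
    rintro _ ⟨i, rfl⟩
    exact Submodule.smul_mem _ _ (Submodule.mem_orthogonal_singleton_iff_inner_right.2 (hF _).1)
  refine le_antisymm (Submodule.topologicalClosure_minimal _ hle
    (Submodule.isClosed_orthogonal _)) ?_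
  rw [← Submodule.orthogonal_orthogonal_eq_closure]
  intro x hx
  rw [Submodule.mem_orthogonal]
  intro G hG
  -- If `G` is orthogonal to all derivatives then its component off `a` has `J`-image orthogonal
  -- to the complete system `ν`.
  set H := (ℝ ∙ a)ᗮ.starProjection G with hH
  have hHa : inner ℝ a H = 0 := Submodule.mem_orthogonal_singleton_iff_inner_right.1
    (Submodule.starProjection_apply_mem _ _)
  have hGH : ∀ x, inner ℝ a x = 0 → inner ℝ x H = inner ℝ x G := by
    intro x hx
    rw [hH, ← Submodule.inner_starProjection_left_eq_right,
      Submodule.starProjection_eq_self_iff.2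
        (Submodule.mem_orthogonal_singleton_iff_inner_right.2 hx)]
  have hJH : J H = 0 := by
    have hmem : J H ∈ (Submodule.span ℝ (range ν))ᗮ := by
      rw [Submodule.mem_orthogonal]
      intro u hu
      induction hu using Submodule.span_induction with
      | zero => simp
      | add x y _ _ hx hy => rw [inner_add_left, hx, hy, add_zero]
      | smul c x _ hx => rw [real_inner_smul_left, hx, mul_zero]
      | mem x hx =>
        obtain ⟨i, rfl⟩ := hx
        rcases i with _ | i
        · obtain ⟨c, -, hc⟩ := exists_smul_eq_of_weakEigen_zero hν hF heig 0 h0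
          rw [hc, real_inner_smul_left, inner_apply_of_adjoint_eq_zero hb, mul_zero]
        · have h1 := (heig (i + 1)).2 _ (J H) H (hF _) ⟨hHa, 0, by simp⟩
          have h2 : inner ℝ (F (i + 1)) G = 0 := by
            have h3 := (Submodule.mem_orthogonal _ _).1 hG _ (Submodule.subset_span ⟨i, rfl⟩)
            rw [real_inner_smul_left] at h3
            exact (mul_eq_zero.1 h3).resolve_left
              (inv_ne_zero (Real.sqrt_pos.2 (weakEigenvalue_pos hν hF heig h0 i)).ne')
          rw [hGH _ (hF _).1, h2] at h1
          exact (mul_eq_zero.1 h1.symm).resolve_left (weakEigenvalue_pos hν hF heig h0 i).ne'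
    rw [(Submodule.topologicalClosure_eq_top_iff).1 hd] at hmem
    exact (Submodule.mem_bot ℝ).1 hmem
  have hH0 : H = 0 := eq_zero_of_apply_eq_zero hJ hHa hJH
  rw [real_inner_comm, ← hGH x (Submodule.mem_orthogonal_singleton_iff_inner_right.1 hx), hH0,
    inner_zero_right]

/-- The vectors with a weak derivative are those whose coefficients in a complete eigensystem are
square summable against the eigenvalues. -/
theorem exists_isWeakDeriv_iff (hb : J.adjoint b = 0)
    (hν : Orthonormal ℝ ν) (hd : (Submodule.span ℝ (range ν)).topologicalClosure = ⊤)
    (hF : ∀ i, IsWeakDeriv J a b (ν i) (F i)) (heig : ∀ i, IsWeakEigen J a b (ν i) (lam i))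
    (h0 : lam 0 = 0) (f : Y) :
    (∃ G, IsWeakDeriv J a b f G) ↔ ∃ α : ℕ → ℝ,
      HasSum (fun i => α (i + 1) • ν (i + 1)) (f - α 0 • b) ∧
        Summable (fun i => lam (i + 1) * α (i + 1) ^ 2) := by
  have hpos := weakEigenvalue_pos hν hF heig h0
  have hon := orthonormal_normalized_deriv hν hF heig h0
  constructor
  -- The weighted coefficients of `f` are the coefficients of its weak derivative with respect to
  -- the normalized derivatives, so Bessel's inequality applies.
  · rintro ⟨G, hG⟩
    obtain ⟨c, hc, hcb⟩ := exists_smul_eq_of_weakEigen_zero hν hF heig 0 h0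
    let B := HilbertBasis.mk hν hd.ge
    have hs : HasSum (fun i => inner ℝ (ν i) f • ν i) f := by
      have := B.hasSum_repr f
      simpa [B, HilbertBasis.repr_apply_apply] using this
    refine ⟨fun i => if i = 0 then inner ℝ (ν 0) f * c else inner ℝ (ν i) f, ?_, ?_⟩
    · rw [← hasSum_nat_add_iff' 1] at hs
      simpa [hcb, smul_smul] using hs
    · have := hon.inner_products_summable G
      refine this.congr fun i => ?_
      have hi := hpos i
      have hs : √(lam (i + 1)) ≠ 0 := (Real.sqrt_pos.2 hi).ne'
      simp only [if_neg (Nat.succ_ne_zero i)]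
      rw [real_inner_smul_left, (heig (i + 1)).2 _ _ _ (hF _) hG,
        Real.norm_eq_abs, sq_abs, mul_pow, mul_pow, inv_pow, Real.sq_sqrt hi.le]
      field_simp
  -- Conversely `∑ αᵢ Fᵢ` converges and `J` maps it to `∑ αᵢ νᵢ`.
  · rintro ⟨α, hα, hsum⟩
    have hsq : Summable fun i => ‖√(lam (i + 1)) * α (i + 1)‖ ^ 2 := by
      refine hsum.congr fun i => ?_
      rw [Real.norm_eq_abs, sq_abs, mul_pow, Real.sq_sqrt (hpos i).le]
    have hG : Summable fun i =>
        (√(lam (i + 1)) * α (i + 1)) • ((√(lam (i + 1)))⁻¹ • F (i + 1)) := by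
      simpa using (hon.orthogonalFamily.summable_iff_norm_sq_summable
        (fun i => √(lam (i + 1)) * α (i + 1))).2 hsq
    have hterm : ∀ i, (√(lam (i + 1)) * α (i + 1)) • ((√(lam (i + 1)))⁻¹ • F (i + 1)) =
        α (i + 1) • F (i + 1) := by
      intro i
      have hs : √(lam (i + 1)) ≠ 0 := (Real.sqrt_pos.2 (hpos i)).ne'
      rw [smul_smul]
      congr 1
      field_simp
    simp only [hterm] at hG
    obtain ⟨G, hG⟩ := hG
    refine ⟨G, ?_, α 0, ?_⟩
    · have h1 := hG.mapL (innerSL ℝ a)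
      have h2 : (fun i => innerSL ℝ a (α (i + 1) • F (i + 1))) = fun _ => (0 : ℝ) := by
        funext i
        rw [innerSL_apply_apply, inner_smul_right, (hF _).1, mul_zero]
      rw [h2] at h1
      exact h1.unique hasSum_zero
    · have h1 := hG.mapL J
      have h2 : (fun i => J (α (i + 1) • F (i + 1))) = fun i => α (i + 1) • ν (i + 1) := by
        funext i
        rw [map_smul, apply_deriv_eq hb hν hF heig h0]
      rw [h2] at h1
      rw [h1.unique hα]
      simp

end Abstract

/-! ### Càdlàg and càglàd functions -/

theorem IsCaglad.comp_neg {f : ℝ → ℝ} (hf : IsCaglad f) : IsCadlag fun x => f (-x) := by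
  intro x
  obtain ⟨h1, l, h2⟩ := hf (-x)
  refine ⟨?_, l, h2.comp ?_⟩
  · refine ContinuousWithinAt.comp (t := Iic (-x)) h1 continuous_neg.continuousWithinAt ?_
    intro y hy
    simpa using hy
  · simpa using tendsto_neg_nhdsLT (a := x)

theorem stronglyMeasurable_of_continuousWithinAt_Ici {E : Type*} [TopologicalSpace E]
    [TopologicalSpace.PseudoMetrizableSpace E] {f : ℝ → E}
    (hf : ∀ x, ContinuousWithinAt f (Ici x) x) : StronglyMeasurable f := by
  -- `f` is the limit of the functions `x ↦ f ((⌊n x⌋ + 1) / n)`, which factor through `ℤ`.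
  have hlim : Tendsto (fun (n : ℕ) x => f (((⌊((n : ℝ) + 1) * x⌋ : ℤ) + 1 : ℝ) / ((n : ℝ) + 1)))
      atTop (𝓝 f) := by
    rw [tendsto_pi_nhds]
    intro x
    have h1 : Tendsto (fun n : ℕ => ((⌊((n : ℝ) + 1) * x⌋ : ℤ) + 1 : ℝ) / ((n : ℝ) + 1)) atTop
        (𝓝[≥] x) := by
      refine tendsto_nhdsWithin_iff.2 ⟨?_, Eventually.of_forall fun n => ?_⟩
      · have h2 : Tendsto (fun n : ℕ => x + 1 / ((n : ℝ) + 1)) atTop (𝓝 x) := by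
          simpa using tendsto_one_div_add_atTop_nhds_zero_nat.const_add x
        refine tendsto_of_tendsto_of_tendsto_of_le_of_le tendsto_const_nhds h2 ?_ ?_
        · intro n
          have hn : (0 : ℝ) < (n : ℝ) + 1 := by positivity
          simp only
          rw [le_div_iff₀ hn, mul_comm]
          exact (Int.lt_floor_add_one _).le
        · intro n
          have hn : (0 : ℝ) < (n : ℝ) + 1 := by positivity
          have := Int.floor_le (((n : ℝ) + 1) * x)
          simp only
          rw [div_le_iff₀ hn]
          field_simp
          linarith
      · have hn : (0 : ℝ) < (n : ℝ) + 1 := by positivity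
        rw [mem_Ici, le_div_iff₀ hn, mul_comm]
        exact (Int.lt_floor_add_one _).le
    exact (hf x).tendsto.comp h1
  refine stronglyMeasurable_of_tendsto atTop (fun n => ?_) hlim
  have h3 : StronglyMeasurable fun k : ℤ => f (((k : ℤ) + 1 : ℝ) / ((n : ℝ) + 1)) :=
    StronglyMeasurable.of_discrete
  exact h3.comp_measurable (Int.measurable_floor.comp (measurable_const_mul _))

theorem IsCadlag.measurable {f : ℝ → ℝ} (hf : IsCadlag f) : Measurable f :=
  (stronglyMeasurable_of_continuousWithinAt_Ici fun x => (hf x).1).measurable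

theorem IsCaglad.measurable {f : ℝ → ℝ} (hf : IsCaglad f) : Measurable f := by
  simpa [Function.comp_def] using (IsCaglad.comp_neg hf).measurable.comp measurable_neg

theorem IsCadlag.bounded_Icc {f : ℝ → ℝ} (hf : IsCadlag f) (a b : ℝ) :
    ∃ C, ∀ x ∈ Icc a b, |f x| ≤ C := by
  refine isCompact_Icc.induction_on (p := fun s => ∃ C, ∀ x ∈ s, |f x| ≤ C) ⟨0, by simp⟩ ?_ ?_ ?_
  · rintro s t hst ⟨C, hC⟩
    exact ⟨C, fun x hx => hC x (hst hx)⟩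
  · rintro s t ⟨C, hC⟩ ⟨D, hD⟩
    refine ⟨max C D, ?_⟩
    rintro x (hx | hx)
    · exact (hC x hx).trans (le_max_left _ _)
    · exact (hD x hx).trans (le_max_right _ _)
  · intro x _
    obtain ⟨h1, l, h2⟩ := hf x
    have e1 : ∀ᶠ y in 𝓝[≥] x, |f y| < max |f x| |l| + 1 :=
      h1.tendsto.abs.eventually_lt_const (by linarith [le_max_left |f x| |l|])
    have e2 : ∀ᶠ y in 𝓝[<] x, |f y| < max |f x| |l| + 1 :=
      h2.abs.eventually_lt_const (by linarith [le_max_right |f x| |l|])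
    have e3 : ∀ᶠ y in 𝓝 x, |f y| < max |f x| |l| + 1 := by
      rw [← nhdsLT_sup_nhdsGE]
      exact eventually_sup.2 ⟨e2, e1⟩
    exact ⟨_, mem_nhdsWithin_of_mem_nhds e3, max |f x| |l| + 1, fun y hy => le_of_lt hy⟩

theorem IsCaglad.bounded_Icc {f : ℝ → ℝ} (hf : IsCaglad f) (a b : ℝ) :
    ∃ C, ∀ x ∈ Icc a b, |f x| ≤ C := by
  obtain ⟨C, hC⟩ := (IsCaglad.comp_neg hf).bounded_Icc (-b) (-a)
  refine ⟨C, fun x hx => ?_⟩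
  simpa using hC (-x) ⟨neg_le_neg hx.2, neg_le_neg hx.1⟩

theorem integrableOn_of_bounded_Icc {m : Measure ℝ} [IsLocallyFiniteMeasure m] {f : ℝ → ℝ}
    (hm : Measurable f) (hb : ∀ a b, ∃ C, ∀ x ∈ Icc a b, |f x| ≤ C) (a b : ℝ) :
    IntegrableOn f (Icc a b) m := by
  obtain ⟨C, hC⟩ := hb a b
  exact IntegrableOn.of_bound measure_Icc_lt_top hm.aestronglyMeasurable C
    ((ae_restrict_mem measurableSet_Icc).mono hC)

theorem IsCadlag.integrableOn {m : Measure ℝ} [IsLocallyFiniteMeasure m] {f : ℝ → ℝ}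
    (hf : IsCadlag f) (a b : ℝ) : IntegrableOn f (Icc a b) m :=
  integrableOn_of_bounded_Icc hf.measurable hf.bounded_Icc a b

theorem IsCaglad.integrableOn {m : Measure ℝ} [IsLocallyFiniteMeasure m] {f : ℝ → ℝ}
    (hf : IsCaglad f) (a b : ℝ) : IntegrableOn f (Icc a b) m :=
  integrableOn_of_bounded_Icc hf.measurable hf.bounded_Icc a b

theorem IsCadlag.sub {f g : ℝ → ℝ} (hf : IsCadlag f) (hg : IsCadlag g) :
    IsCadlag fun x => f x - g x := by
  intro x
  obtain ⟨h1, l, h2⟩ := hf x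
  obtain ⟨h3, k, h4⟩ := hg x
  exact ⟨h1.sub h3, l - k, h2.sub h4⟩

theorem isCadlag_const (c : ℝ) : IsCadlag fun _ => c :=
  fun _ => ⟨continuousWithinAt_const, c, tendsto_const_nhds⟩

theorem IsCaglad.sub {f g : ℝ → ℝ} (hf : IsCaglad f) (hg : IsCaglad g) :
    IsCaglad fun x => f x - g x := by
  intro x
  obtain ⟨h1, l, h2⟩ := hf x
  obtain ⟨h3, k, h4⟩ := hg x
  exact ⟨h1.sub h3, l - k, h2.sub h4⟩

theorem isCaglad_const (c : ℝ) : IsCaglad fun _ => c :=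
  fun _ => ⟨continuousWithinAt_const, c, tendsto_const_nhds⟩

theorem IsCadlag.comp_add_const {f : ℝ → ℝ} (hf : IsCadlag f) (c : ℝ) :
    IsCadlag fun x => f (x + c) := by
  intro x
  obtain ⟨h1, l, h2⟩ := hf (x + c)
  refine ⟨?_, l, h2.comp ?_⟩
  · refine ContinuousWithinAt.comp (t := Ici (x + c)) h1 (by fun_prop) ?_
    intro y hy
    simpa using hy
  · exact tendsto_nhdsWithin_of_tendsto_nhds_of_eventually_within _
      ((continuous_add_const c).continuousAt.mono_left nhdsWithin_le_nhds)
      (eventually_mem_nhdsWithin.mono fun y hy => by simpa using hy)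

theorem IsCaglad.comp_add_const {f : ℝ → ℝ} (hf : IsCaglad f) (c : ℝ) :
    IsCaglad fun x => f (x + c) := by
  intro x
  obtain ⟨h1, l, h2⟩ := hf (x + c)
  refine ⟨?_, l, h2.comp ?_⟩
  · refine ContinuousWithinAt.comp (t := Iic (x + c)) h1 (by fun_prop) ?_
    intro y hy
    simpa using hy
  · exact tendsto_nhdsWithin_of_tendsto_nhds_of_eventually_within _
      ((continuous_add_const c).continuousAt.mono_left nhdsWithin_le_nhds)
      (eventually_mem_nhdsWithin.mono fun y hy => by simpa using hy)

/-- The `1`-periodic extension of a càdlàg function from `[0, 1)` is càdlàg. -/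
theorem IsCadlag.comp_fract {f : ℝ → ℝ} (hf : IsCadlag f) : IsCadlag fun x => f (Int.fract x) := by
  intro x
  -- To the right of `x` the floor is `⌊x⌋`, to the left it is `⌈x⌉ - 1`.
  have hfl : ∀ n : ℤ, ∀ y : ℝ, (n : ℝ) ≤ y → y < n + 1 → f (Int.fract y) = f (y + -(n : ℝ)) := by
    intro n y h1 h2
    rw [Int.fract, Int.floor_eq_iff.2 ⟨h1, h2⟩, sub_eq_add_neg]
  constructor
  · refine ((hf.comp_add_const (-(⌊x⌋ : ℝ))) x).1.congr_of_eventuallyEq ?_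
      (hfl _ _ (Int.floor_le x) (Int.lt_floor_add_one x))
    filter_upwards [Ico_mem_nhdsGE (Int.lt_floor_add_one x)] with y hy
    exact hfl _ _ ((Int.floor_le x).trans hy.1) hy.2
  · obtain ⟨l, hl⟩ := ((hf.comp_add_const (-((⌈x⌉ - 1 : ℤ) : ℝ))) x).2
    refine ⟨l, hl.congr' ?_⟩
    have h1 : ((⌈x⌉ - 1 : ℤ) : ℝ) < x := by
      push_cast
      linarith [Int.ceil_lt_add_one x]
    filter_upwards [Ioo_mem_nhdsLT h1] with y hy
    refine (hfl _ _ hy.1.le (hy.2.trans_le ?_)).symm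
    push_cast
    linarith [Int.le_ceil x]

/-! ### Integrals over half-lines -/

theorem tendsto_setIntegral_of_eventually_mem_iff {m : Measure ℝ} {l : Filter ℝ}
    [l.IsCountablyGenerated] {S : ℝ → Set ℝ} {A : Set ℝ} {g : ℝ → ℝ} (hg : Integrable g m)
    (hS : ∀ y, MeasurableSet (S y)) (hA : MeasurableSet A)
    (h : ∀ s, ∀ᶠ y in l, (s ∈ S y ↔ s ∈ A)) :
    Tendsto (fun y => ∫ s in S y, g s ∂m) l (𝓝 (∫ s in A, g s ∂m)) := by
  simp only [← integral_indicator hA, ← integral_indicator (hS _)]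
  refine tendsto_integral_filter_of_dominated_convergence (fun s => ‖g s‖)
    (Eventually.of_forall fun y => hg.aestronglyMeasurable.indicator (hS y))
    (Eventually.of_forall fun y => Eventually.of_forall fun s => norm_indicator_le_norm_self _ _)
    hg.norm (Eventually.of_forall fun s => ?_)
  refine tendsto_const_nhds.congr' ?_
  filter_upwards [h s] with y hy
  by_cases hs : s ∈ A
  · rw [indicator_of_mem hs, indicator_of_mem (hy.2 hs)]
  · rw [indicator_of_notMem hs, indicator_of_notMem fun h => hs (hy.1 h)]

theorem isCadlag_setIntegral_Iic {m : Measure ℝ} {g : ℝ → ℝ} (hg : Integrable g m) :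
    IsCadlag fun y => ∫ s in Iic y, g s ∂m := by
  intro x
  refine ⟨?_, ∫ s in Iio x, g s ∂m, ?_⟩
  · refine tendsto_setIntegral_of_eventually_mem_iff hg (fun _ => measurableSet_Iic)
      measurableSet_Iic fun s => ?_
    rcases le_or_gt s x with h | h
    · filter_upwards [self_mem_nhdsWithin] with y hy
      exact ⟨fun _ => h, fun _ => h.trans hy⟩
    · filter_upwards [mem_nhdsWithin_of_mem_nhds (Iio_mem_nhds h)] with y hy
      exact ⟨fun h' => absurd (mem_Iio.1 hy) (not_lt.2 h'), fun h' => absurd h (not_lt.2 h')⟩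
  · refine tendsto_setIntegral_of_eventually_mem_iff hg (fun _ => measurableSet_Iic)
      measurableSet_Iio fun s => ?_
    rcases lt_or_ge s x with h | h
    · filter_upwards [mem_nhdsWithin_of_mem_nhds (Ioi_mem_nhds h)] with y hy
      exact ⟨fun _ => h, fun _ => (mem_Ioi.1 hy).le⟩
    · filter_upwards [self_mem_nhdsWithin] with y hy
      exact ⟨fun h' => absurd (lt_of_le_of_lt h' hy) (not_lt.2 h),
        fun h' => absurd h' (not_lt.2 h)⟩

theorem isCaglad_setIntegral_Iio {m : Measure ℝ} {g : ℝ → ℝ} (hg : Integrable g m) :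
    IsCaglad fun y => ∫ s in Iio y, g s ∂m := by
  intro x
  refine ⟨?_, ∫ s in Iic x, g s ∂m, ?_⟩
  · refine tendsto_setIntegral_of_eventually_mem_iff hg (fun _ => measurableSet_Iio)
      measurableSet_Iio fun s => ?_
    rcases lt_or_ge s x with h | h
    · filter_upwards [mem_nhdsWithin_of_mem_nhds (Ioi_mem_nhds h)] with y hy
      exact ⟨fun _ => h, fun _ => hy⟩
    · filter_upwards [self_mem_nhdsWithin] with y hy
      exact ⟨fun h' => absurd (lt_of_lt_of_le h' hy) (not_lt.2 h),
        fun h' => absurd h' (not_lt.2 h)⟩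
  · refine tendsto_setIntegral_of_eventually_mem_iff hg (fun _ => measurableSet_Iio)
      measurableSet_Iic fun s => ?_
    rcases le_or_gt s x with h | h
    · filter_upwards [self_mem_nhdsWithin] with y hy
      exact ⟨fun _ => h, fun _ => lt_of_le_of_lt h hy⟩
    · filter_upwards [mem_nhdsWithin_of_mem_nhds (Iio_mem_nhds h)] with y hy
      exact ⟨fun h' => absurd (mem_Iio.1 h') (not_lt.2 (le_of_lt (mem_Iio.1 hy))),
        fun h' => absurd h (not_lt.2 h')⟩

theorem isCaglad_setIntegral_Ici {m : Measure ℝ} {g : ℝ → ℝ} (hg : Integrable g m) :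
    IsCaglad fun y => ∫ s in Ici y, g s ∂m := by
  have : (fun y => ∫ s in Ici y, g s ∂m) = fun y => ∫ s, g s ∂m - ∫ s in Iio y, g s ∂m := by
    funext y
    rw [← integral_add_compl (measurableSet_Iio (a := y)) hg, compl_Iio, add_sub_cancel_left]
  rw [this]
  exact (isCaglad_const _).sub (isCaglad_setIntegral_Iio hg)

theorem isCadlag_of_eventuallyEq {f : ℝ → ℝ} (h : ∀ x, ∃ g, IsCadlag g ∧ f =ᶠ[𝓝 x] g) :
    IsCadlag f := by
  intro x
  obtain ⟨g, hg, hfg⟩ := h x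
  obtain ⟨h1, l, h2⟩ := hg x
  exact ⟨h1.congr_of_eventuallyEq (hfg.filter_mono nhdsWithin_le_nhds) hfg.eq_of_nhds, l,
    h2.congr' (hfg.symm.filter_mono nhdsWithin_le_nhds)⟩

theorem isCaglad_of_eventuallyEq {f : ℝ → ℝ} (h : ∀ x, ∃ g, IsCaglad g ∧ f =ᶠ[𝓝 x] g) :
    IsCaglad f := by
  intro x
  obtain ⟨g, hg, hfg⟩ := h x
  obtain ⟨h1, l, h2⟩ := hg x
  exact ⟨h1.congr_of_eventuallyEq (hfg.filter_mono nhdsWithin_le_nhds) hfg.eq_of_nhds, l,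
    h2.congr' (hfg.symm.filter_mono nhdsWithin_le_nhds)⟩

/-- An integrable function whose integral vanishes on a generating `π`-system and on the whole
space is zero almost everywhere. -/
theorem ae_eq_zero_of_setIntegral_piSystem {α : Type*} [mα : MeasurableSpace α] {m : Measure α}
    {C : Set (Set α)} (hgen : mα = MeasurableSpace.generateFrom C) (hpi : IsPiSystem C)
    {F : α → ℝ} (hF : Integrable F m) (huniv : ∫ x, F x ∂m = 0)
    (h : ∀ s ∈ C, ∫ x in s, F x ∂m = 0) : F =ᵐ[m] 0 := by
  refine hF.ae_eq_zero_of_forall_setIntegral_eq_zero fun s hs _ => ?_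
  clear * - hgen hpi hF huniv h hs
  induction s, hs using MeasurableSpace.induction_on_inter hgen hpi with
  | empty => simp
  | basic t ht => exact h t ht
  | compl t ht ih => rw [setIntegral_compl ht hF, huniv, ih, sub_zero]
  | iUnion f hd hf ih =>
    rw [integral_iUnion hf hd hF.integrableOn]
    simp [ih]

/-! ### Primitives with respect to a measure on the line -/

section Primitive

variable {m : Measure ℝ} {f g : ℝ → ℝ}

theorem isCadlag_of_sub_eq_setIntegral_Ioc (hg : ∀ a b, IntegrableOn g (Icc a b) m)
    (h : ∀ a b, a ≤ b → f b - f a = ∫ s in Ioc a b, g s ∂m) : IsCadlag f := by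
  refine isCadlag_of_eventuallyEq fun x =>
    ⟨fun y => (∫ s in Iic y, g s ∂(m.restrict (Ioc (x - 1) (x + 1)))) - (-f (x - 1)),
      (isCadlag_setIntegral_Iic ((hg (x - 1) (x + 1)).mono_set Ioc_subset_Icc_self)).sub
        (isCadlag_const _), ?_⟩
  filter_upwards [Ioo_mem_nhds (show x - 1 < x by linarith) (show x < x + 1 by linarith)] with y hy
  rw [Measure.restrict_restrict measurableSet_Iic,
    show Iic y ∩ Ioc (x - 1) (x + 1) = Ioc (x - 1) y by
      ext s; simp only [mem_inter_iff, mem_Iic, mem_Ioc]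
      exact ⟨fun h => ⟨h.2.1, h.1⟩, fun h => ⟨h.2, h.1, h.2.trans hy.2.le⟩⟩, ← h _ _ hy.1.le]
  ring

theorem isCaglad_of_sub_eq_setIntegral_Ico (hg : ∀ a b, IntegrableOn g (Icc a b) m)
    (h : ∀ a b, a ≤ b → f b - f a = ∫ s in Ico a b, g s ∂m) : IsCaglad f := by
  refine isCaglad_of_eventuallyEq fun x =>
    ⟨fun y => (∫ s in Iio y, g s ∂(m.restrict (Ico (x - 1) (x + 1)))) - (-f (x - 1)),
      (isCaglad_setIntegral_Iio ((hg (x - 1) (x + 1)).mono_set Ico_subset_Icc_self)).sub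
        (isCaglad_const _), ?_⟩
  filter_upwards [Ioo_mem_nhds (show x - 1 < x by linarith) (show x < x + 1 by linarith)] with y hy
  rw [Measure.restrict_restrict measurableSet_Iio,
    show Iio y ∩ Ico (x - 1) (x + 1) = Ico (x - 1) y by
      ext s; simp only [mem_inter_iff, mem_Iio, mem_Ico]
      exact ⟨fun h => ⟨h.2.1, h.1⟩, fun h => ⟨h.2, h.1, h.2.trans hy.2⟩⟩, ← h _ _ hy.1.le]
  ring

theorem exists_sub_eq_setIntegral_Ioc (hg : ∀ a b, IntegrableOn g (Icc a b) m) (c : ℝ) :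
    ∃ f : ℝ → ℝ, f 0 = c ∧ ∀ a b, a ≤ b → f b - f a = ∫ s in Ioc a b, g s ∂m := by
  have hi : ∀ a b, IntervalIntegrable g m a b := fun a b =>
    ⟨(hg a b).mono_set Ioc_subset_Icc_self, (hg b a).mono_set Ioc_subset_Icc_self⟩
  refine ⟨fun x => c + ∫ s in (0)..x, g s ∂m, by simp, fun a b hab => ?_⟩
  rw [add_sub_add_left_eq_sub, intervalIntegral.integral_interval_sub_left (hi _ _) (hi _ _),
    intervalIntegral.integral_of_le hab]

theorem exists_sub_eq_setIntegral_Ico (hg : ∀ a b, IntegrableOn g (Icc a b) m) (c : ℝ) :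
    ∃ f : ℝ → ℝ, f 0 = c ∧ ∀ a b, a ≤ b → f b - f a = ∫ s in Ico a b, g s ∂m := by
  have hi : ∀ a b, IntegrableOn g (Ico a b) m := fun a b => (hg a b).mono_set Ico_subset_Icc_self
  have hadd : ∀ a b d, a ≤ b → b ≤ d →
      ∫ s in Ico a d, g s ∂m = (∫ s in Ico a b, g s ∂m) + ∫ s in Ico b d, g s ∂m := by
    intro a b d hab hbd
    rw [← Ico_union_Ico_eq_Ico hab hbd, setIntegral_union
      (Ico_disjoint_Ico_same) measurableSet_Ico (hi _ _) (hi _ _)]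
  refine ⟨fun x => c + ((∫ s in Ico 0 x, g s ∂m) - ∫ s in Ico x 0, g s ∂m), by simp, ?_⟩
  intro a b hab
  simp only
  rcases le_total 0 a with ha | ha
  · rw [hadd 0 a b ha hab, Ico_eq_empty_of_le ha, Ico_eq_empty_of_le (ha.trans hab)]
    simp
  · rcases le_total 0 b with hb | hb
    · rw [hadd a 0 b ha hb, Ico_eq_empty_of_le ha, Ico_eq_empty_of_le hb]
      simp
      ring
    · rw [hadd a b 0 hab hb, Ico_eq_empty_of_le ha, Ico_eq_empty_of_le hb]
      simp

theorem abs_setIntegral_div_sub_le {s : Set ℝ} (hpos : 0 < m.real s)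
    (hg : IntegrableOn g s m) {c ε : ℝ} (hε : ∀ x ∈ s, |g x - c| ≤ ε) :
    |(∫ x in s, g x ∂m) / m.real s - c| ≤ ε := by
  have hfin : m s < ⊤ := by
    by_contra h
    rw [not_lt, top_le_iff] at h
    simp [Measure.real, h] at hpos
  have h1 : ∫ x in s, (g x - c) ∂m = (∫ x in s, g x ∂m) - c * m.real s := by
    rw [integral_sub hg (integrableOn_const hfin.ne), setIntegral_const, smul_eq_mul, mul_comm]
  have h2 := norm_setIntegral_le_of_norm_le_const hfin (f := fun x => g x - c) hε
  rw [h1, Real.norm_eq_abs] at h2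
  rw [show (∫ x in s, g x ∂m) / m.real s - c = ((∫ x in s, g x ∂m) - c * m.real s) / m.real s by
    field_simp, abs_div, abs_of_pos hpos, div_le_iff₀ hpos]
  exact h2

/-- The left quotient of a primitive over intervals `(a, b]` is an average of `g` to the left of
`x`. -/
theorem tendsto_leftQuotient {W : ℝ → ℝ} (hW : StrictMono W)
    (hm : ∀ a b, a ≤ b → m.real (Ioc a b) = W b - W a) (hg : ∀ a b, IntegrableOn g (Icc a b) m)
    (h : ∀ a b, a ≤ b → f b - f a = ∫ s in Ioc a b, g s ∂m) {x : ℝ}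
    (hc : ContinuousWithinAt g (Iic x) x) :
    Tendsto (fun y => (f y - f x) / (W y - W x)) (𝓝[<] x) (𝓝 (g x)) := by
  rw [Metric.tendsto_nhds]
  intro ε hε
  have h1 : ∀ᶠ y in 𝓝[≤] x, |g y - g x| < ε / 2 := Metric.tendsto_nhds.1 hc _ (half_pos hε)
  obtain ⟨l, hl, hlx⟩ := mem_nhdsLE_iff_exists_Ioc_subset.1 h1
  filter_upwards [Ioo_mem_nhdsLT hl] with y hy
  have h2 : (f y - f x) / (W y - W x) = (∫ s in Ioc y x, g s ∂m) / m.real (Ioc y x) := by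
    rw [← h y x hy.2.le, hm y x hy.2.le, ← neg_sub (f x), ← neg_sub (W x), neg_div_neg_eq]
  rw [Real.dist_eq, h2]
  refine lt_of_le_of_lt (abs_setIntegral_div_sub_le ?_
    ((hg y x).mono_set Ioc_subset_Icc_self) (ε := ε / 2) fun z hz => ?_) (half_lt_self hε)
  · rw [hm y x hy.2.le]
    exact sub_pos.2 (hW hy.2)
  · exact le_of_lt (hlx ⟨hy.1.trans hz.1, hz.2⟩)

theorem tendsto_rightQuotient {V : ℝ → ℝ} (hV : StrictMono V)
    (hm : ∀ a b, a ≤ b → m.real (Ico a b) = V b - V a) (hg : ∀ a b, IntegrableOn g (Icc a b) m)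
    (h : ∀ a b, a ≤ b → f b - f a = ∫ s in Ico a b, g s ∂m) {x : ℝ}
    (hc : ContinuousWithinAt g (Ici x) x) :
    Tendsto (fun y => (f y - f x) / (V y - V x)) (𝓝[>] x) (𝓝 (g x)) := by
  rw [Metric.tendsto_nhds]
  intro ε hε
  have h1 : ∀ᶠ y in 𝓝[≥] x, |g y - g x| < ε / 2 := Metric.tendsto_nhds.1 hc _ (half_pos hε)
  obtain ⟨l, hl, hlx⟩ := mem_nhdsGE_iff_exists_Ico_subset.1 h1
  filter_upwards [Ioo_mem_nhdsGT hl] with y hy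
  rw [h x y hy.1.le, ← hm x y hy.1.le, Real.dist_eq]
  refine lt_of_le_of_lt (abs_setIntegral_div_sub_le ?_
    ((hg x y).mono_set Ico_subset_Icc_self) (ε := ε / 2) fun z hz => ?_) (half_lt_self hε)
  · rw [hm x y hy.1.le]
    exact sub_pos.2 (hV hy.1)
  · exact le_of_lt (hlx ⟨hz.1, hz.2.trans hy.2⟩)

end Primitive

/-! ### Functions with vanishing one-sided derivative -/

/-- A right-continuous function with vanishing left derivative with respect to a strictly increasing
right-continuous function is constant. -/
theorem eq_of_leftQuotient_tendsto_zero {W h : ℝ → ℝ} (hW : StrictMono W)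
    (hWc : ∀ x, ContinuousWithinAt W (Ici x) x) (hh : ∀ x, ContinuousWithinAt h (Ici x) x)
    (hd : ∀ x, Tendsto (fun y => (h y - h x) / (W y - W x)) (𝓝[<] x) (𝓝 0)) (a b : ℝ) :
    h a = h b := by
  wlog hab : a ≤ b generalizing a b
  · exact (this b a (le_of_not_ge hab)).symm
  have key : ∀ ε > 0, |h b - h a| ≤ ε * (W b - W a) := by
    intro ε hε
    -- Move the left end point from `b` down to `a`: right continuity passes to the infimum, and
    -- the vanishing left derivative goes past it.
    set S : Set ℝ := {x | x ∈ Icc a b ∧ |h b - h x| ≤ ε * (W b - W x)} with hS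
    have hbS : b ∈ S := ⟨right_mem_Icc.2 hab, by simp⟩
    have hbdd : BddBelow S := ⟨a, fun x hx => hx.1.1⟩
    set s := sInf S with hs
    have has : a ≤ s := le_csInf ⟨b, hbS⟩ fun x hx => hx.1.1
    have hsb : s ≤ b := csInf_le hbdd hbS
    have hsS : |h b - h s| ≤ ε * (W b - W s) := by
      by_contra hcon
      rw [not_le] at hcon
      have e1 : Tendsto (fun y => ε * (W b - W y)) (𝓝[≥] s) (𝓝 (ε * (W b - W s))) :=
        ((hWc s).tendsto.const_sub _).const_mul _
      have e2 : Tendsto (fun y => |h b - h y|) (𝓝[≥] s) (𝓝 |h b - h s|) :=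
        ((hh s).tendsto.const_sub _).abs
      have e3 := e1.eventually_lt e2 hcon
      obtain ⟨u, hu, hus⟩ := mem_nhdsGE_iff_exists_Ico_subset.1 e3
      obtain ⟨x, hx, hxu⟩ := exists_lt_of_csInf_lt ⟨b, hbS⟩ (show sInf S < u from hu)
      have := hus ⟨csInf_le hbdd hx, hxu⟩
      exact absurd hx.2 (not_le.2 this)
    rcases has.eq_or_lt with h' | h'
    · rw [h']; exact hsS
    · exfalso
      have e1 : ∀ᶠ y in 𝓝[<] s, |(h y - h s) / (W y - W s) - 0| < ε :=
        Metric.tendsto_nhds.1 (hd s) ε hε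
      obtain ⟨y, hy, hya, hys⟩ := (e1.and (Ioo_mem_nhdsLT h')).exists
      have hpos : 0 < W s - W y := sub_pos.2 (hW hys)
      rw [sub_zero, abs_div, abs_sub_comm (W y), abs_of_pos hpos, div_lt_iff₀ hpos] at hy
      refine absurd (csInf_le hbdd (a := y) ⟨⟨hya.le, hys.le.trans hsb⟩, ?_⟩) (not_le.2 hys)
      calc |h b - h y| ≤ |h b - h s| + |h s - h y| := abs_sub_le _ _ _
        _ ≤ ε * (W b - W s) + ε * (W s - W y) := by
          rw [abs_sub_comm (h s)]; exact add_le_add hsS hy.le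
        _ = ε * (W b - W y) := by ring
  have h0 : |h b - h a| ≤ 0 := by
    have : Tendsto (fun ε : ℝ => ε * (W b - W a)) (𝓝[>] 0) (𝓝 0) := by
      have : Tendsto (fun ε : ℝ => ε * (W b - W a)) (𝓝 0) (𝓝 (0 * (W b - W a))) :=
        tendsto_id.mul_const _
      rw [zero_mul] at this
      exact this.mono_left nhdsWithin_le_nhds
    exact ge_of_tendsto this (eventually_mem_nhdsWithin.mono fun ε hε => key ε hε)
  linarith [abs_nonpos_iff.1 h0]

theorem eq_of_rightQuotient_tendsto_zero {V h : ℝ → ℝ} (hV : StrictMono V)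
    (hVc : ∀ x, ContinuousWithinAt V (Iic x) x) (hh : ∀ x, ContinuousWithinAt h (Iic x) x)
    (hd : ∀ x, Tendsto (fun y => (h y - h x) / (V y - V x)) (𝓝[>] x) (𝓝 0)) (a b : ℝ) :
    h a = h b := by
  have hcont : ∀ k : ℝ → ℝ, (∀ x, ContinuousWithinAt k (Iic x) x) →
      ∀ x, ContinuousWithinAt (fun y => k (-y)) (Ici x) x := by
    intro k hk x
    refine ContinuousWithinAt.comp (t := Iic (-x)) (hk (-x)) continuous_neg.continuousWithinAt ?_
    intro y hy
    simpa using hy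
  have := eq_of_leftQuotient_tendsto_zero (W := fun x => -V (-x)) (h := fun x => -h (-x))
    (fun x y hxy => neg_lt_neg (hV (neg_lt_neg hxy))) (fun x => (hcont V hVc x).neg)
    (fun x => (hcont h hh x).neg) (fun x => ?_) (-a) (-b)
  · simpa using this
  · refine ((hd (-x)).comp tendsto_neg_nhdsLT).congr fun y => ?_
    simp only [Function.comp]
    rw [show -h (-y) - -h (-x) = -(h (-y) - h (-x)) by ring,
      show -V (-y) - -V (-x) = -(V (-y) - V (-x)) by ring, neg_div_neg_eq]

/-- One-sided Newton-Leibniz formula: a right-continuous function with càglàd left `W`-derivative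
`g` is a primitive of `g`. -/
theorem sub_eq_setIntegral_of_leftQuotient {m : Measure ℝ} [IsLocallyFiniteMeasure m]
    {W f g : ℝ → ℝ} (hW : StrictMono W) (hWc : ∀ x, ContinuousWithinAt W (Ici x) x)
    (hm : ∀ a b, a ≤ b → m.real (Ioc a b) = W b - W a)
    (hf : ∀ x, ContinuousWithinAt f (Ici x) x) (hg : IsCaglad g)
    (hd : ∀ x, Tendsto (fun y => (f y - f x) / (W y - W x)) (𝓝[<] x) (𝓝 (g x)))
    (a b : ℝ) (hab : a ≤ b) : f b - f a = ∫ s in Ioc a b, g s ∂m := by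
  have hgi : ∀ a b, IntegrableOn g (Icc a b) m := hg.integrableOn
  obtain ⟨k, -, hk⟩ := exists_sub_eq_setIntegral_Ioc hgi 0
  have hkc := isCadlag_of_sub_eq_setIntegral_Ioc hgi hk
  have := eq_of_leftQuotient_tendsto_zero (h := fun x => f x - k x) hW hWc
    (fun x => (hf x).sub (hkc x).1) (fun x => ?_) a b
  · rw [← hk a b hab]
    linarith
  · have h1 := (hd x).sub (tendsto_leftQuotient hW hm hgi hk (hg x).1)
    rw [sub_self] at h1
    refine h1.congr fun y => ?_
    rw [← sub_div]
    congr 1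
    ring

theorem sub_eq_setIntegral_of_rightQuotient {m : Measure ℝ} [IsLocallyFiniteMeasure m]
    {V f g : ℝ → ℝ} (hV : StrictMono V) (hVc : ∀ x, ContinuousWithinAt V (Iic x) x)
    (hm : ∀ a b, a ≤ b → m.real (Ico a b) = V b - V a)
    (hf : ∀ x, ContinuousWithinAt f (Iic x) x) (hg : IsCadlag g)
    (hd : ∀ x, Tendsto (fun y => (f y - f x) / (V y - V x)) (𝓝[>] x) (𝓝 (g x)))
    (a b : ℝ) (hab : a ≤ b) : f b - f a = ∫ s in Ico a b, g s ∂m := by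
  have hgi : ∀ a b, IntegrableOn g (Icc a b) m := hg.integrableOn
  obtain ⟨k, -, hk⟩ := exists_sub_eq_setIntegral_Ico hgi 0
  have hkc := isCaglad_of_sub_eq_setIntegral_Ico hgi hk
  have := eq_of_rightQuotient_tendsto_zero (h := fun x => f x - k x) hV hVc
    (fun x => (hf x).sub (hkc x).1) (fun x => ?_) a b
  · rw [← hk a b hab]
    linarith
  · have h1 := (hd x).sub (tendsto_rightQuotient hV hm hgi hk (hg x).1)
    rw [sub_self] at h1
    refine h1.congr fun y => ?_
    rw [← sub_div]
    congr 1
    ring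

theorem tendsto_add_one_nhdsLT (x : ℝ) : Tendsto (fun y : ℝ => y + 1) (𝓝[<] x) (𝓝[<] (x + 1)) :=
  tendsto_nhdsWithin_of_tendsto_nhds_of_eventually_within _
    ((continuous_add_const 1).continuousAt.mono_left nhdsWithin_le_nhds)
    (eventually_mem_nhdsWithin.mono fun y hy => by simpa using hy)

theorem tendsto_add_one_nhdsGT (x : ℝ) : Tendsto (fun y : ℝ => y + 1) (𝓝[>] x) (𝓝[>] (x + 1)) :=
  tendsto_nhdsWithin_of_tendsto_nhds_of_eventually_within _
    ((continuous_add_const 1).continuousAt.mono_left nhdsWithin_le_nhds)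
    (eventually_mem_nhdsWithin.mono fun y hy => by simpa using hy)

namespace WeightPair

variable (p : WeightPair)

/-! ### The measures of a pair of weights -/

/-- The Stieltjes measure of `W` on the whole line. -/
def mW : Measure ℝ := p.strictMono_W.monotone.stieltjesFunction.measure

/-- The Stieltjes measure of `V` on the whole line. -/
def mV : Measure ℝ := p.strictMono_V.monotone.stieltjesFunction.measure

instance : IsLocallyFiniteMeasure p.mW := by unfold mW; infer_instance

instance : IsLocallyFiniteMeasure p.mV := by unfold mV; infer_instance

theorem μW_eq : p.μW = p.mW.restrict (Ioc 0 1) := rfl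

theorem mW_real_Ioc (a b : ℝ) (hab : a ≤ b) : p.mW.real (Ioc a b) = p.W b - p.W a := by
  have h : ∀ x, p.strictMono_W.monotone.stieltjesFunction x = p.W x := fun x =>
    (p.cadlag_W x).1.rightLim_eq
  rw [mW, Measure.real, StieltjesFunction.measure_Ioc, h, h,
    ENNReal.toReal_ofReal (sub_nonneg.2 (p.strictMono_W.monotone hab))]

/-- `Monotone.stieltjesFunction` makes `V` right-continuous; its left limits give `V` back. -/
theorem leftLim_stieltjes_V (x : ℝ) :
    Function.leftLim p.strictMono_V.monotone.stieltjesFunction x = p.V x := by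
  have h : (p.strictMono_V.monotone.stieltjesFunction : ℝ → ℝ) = Function.rightLim p.V := by
    funext y
    rw [Monotone.stieltjesFunction_eq]
  rw [h, leftLim_rightLim]
  · exact (p.caglad_V x).1.leftLim_eq
  · exact p.strictMono_V.monotone.tendsto_leftLim x

theorem mV_real_Ico (a b : ℝ) (hab : a ≤ b) : p.mV.real (Ico a b) = p.V b - p.V a := by
  rw [mV, Measure.real, StieltjesFunction.measure_Ico, leftLim_stieltjes_V, leftLim_stieltjes_V,
    ENNReal.toReal_ofReal (sub_nonneg.2 (p.strictMono_V.monotone hab))]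

theorem mV_singleton {x : ℝ} (hx : ContinuousAt p.V x) : p.mV {x} = 0 := by
  rw [mV, StieltjesFunction.measure_singleton, leftLim_stieltjes_V,
    Monotone.stieltjesFunction_eq, hx.continuousWithinAt.rightLim_eq, sub_self,
    ENNReal.ofReal_zero]

theorem continuousAt_V_one : ContinuousAt p.V 1 := by
  have h : p.V = fun x => p.V (x - 1) + (p.V 1 - p.V 0) := by
    funext x
    have := p.periodic_V (x - 1)
    rw [sub_add_cancel] at this
    linarith
  rw [h]
  refine ContinuousAt.add (ContinuousAt.comp (g := p.V) ?_ (by fun_prop)) continuousAt_const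
  simpa using p.continuousAt_V

/-- As `V` is continuous at the integers, the fundamental domains `(0, 1]` and `[0, 1)` give the
same measure. -/
theorem μV_eq : p.μV = p.mV.restrict (Ico 0 1) :=
  Measure.restrict_congr_set (Ico_ae_eq_Ioc' (p.mV_singleton p.continuousAt_V)
    (p.mV_singleton p.continuousAt_V_one)).symm

theorem ae_mem_Ioc_μW : ∀ᵐ x ∂p.μW, x ∈ Ioc (0 : ℝ) 1 := ae_restrict_mem measurableSet_Ioc

theorem ae_mem_Ico_μV : ∀ᵐ x ∂p.μV, x ∈ Ico (0 : ℝ) 1 := by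
  rw [μV_eq]
  exact ae_restrict_mem measurableSet_Ico

theorem μW_real_univ_pos : 0 < p.μW.real univ := by
  rw [μW_eq, measureReal_restrict_apply_univ, mW_real_Ioc _ _ _ zero_le_one]
  exact sub_pos.2 (p.strictMono_W zero_lt_one)

theorem μV_real_univ_pos : 0 < p.μV.real univ := by
  rw [μV_eq, measureReal_restrict_apply_univ, mV_real_Ico _ _ _ zero_le_one]
  exact sub_pos.2 (p.strictMono_V zero_lt_one)

theorem setIntegral_Iic_μW (F : ℝ → ℝ) {x : ℝ} (hx : x ≤ 1) :
    ∫ s in Iic x, F s ∂p.μW = ∫ s in Ioc 0 x, F s ∂p.mW := by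
  rw [μW_eq, Measure.restrict_restrict measurableSet_Iic]
  congr 2
  ext s
  simp only [mem_inter_iff, mem_Iic, mem_Ioc]
  exact ⟨fun h => ⟨h.2.1, h.1⟩, fun h => ⟨h.2, h.1, h.2.trans hx⟩⟩

theorem setIntegral_Ioc_μW (F : ℝ → ℝ) (x : ℝ) :
    ∫ s in Ioc 0 x, F s ∂p.μW = ∫ s in Iic x, F s ∂p.μW := by
  rw [μW_eq, Measure.restrict_restrict measurableSet_Iic,
    Measure.restrict_restrict measurableSet_Ioc]
  congr 2
  ext s
  simp only [mem_inter_iff, mem_Iic, mem_Ioc]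
  exact ⟨fun h => ⟨h.1.2, h.2⟩, fun h => ⟨⟨h.2.1, h.1⟩, h.2⟩⟩

theorem setIntegral_Ici_μV (F : ℝ → ℝ) {x : ℝ} (hx : 0 ≤ x) :
    ∫ s in Ici x, F s ∂p.μV = ∫ s in Ico x 1, F s ∂p.mV := by
  rw [μV_eq, Measure.restrict_restrict measurableSet_Ici]
  congr 2
  ext s
  simp only [mem_inter_iff, mem_Ici, mem_Ico]
  exact ⟨fun h => ⟨h.1, h.2.2⟩, fun h => ⟨h.1, hx.trans h.1, h.2⟩⟩

theorem integral_μW (F : ℝ → ℝ) : ∫ s, F s ∂p.μW = ∫ s in Ioc 0 1, F s ∂p.mW := rfl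

theorem integral_μV (F : ℝ → ℝ) : ∫ s, F s ∂p.μV = ∫ s in Ico 0 1, F s ∂p.mV := by rw [μV_eq]

variable {p}

/-- `μV` charges every interval `[x, y)` in `[0, 1)`, so a right-continuous function that vanishes
almost everywhere vanishes on `[0, 1)`. -/
theorem eq_zero_of_ae_μV {h : ℝ → ℝ} (hc : ∀ x, ContinuousWithinAt h (Ici x) x)
    (hae : ∀ᵐ x ∂p.μV, h x = 0) {x : ℝ} (hx : x ∈ Ico (0 : ℝ) 1) : h x = 0 := by
  by_contra hne
  have e : ∀ᶠ y in 𝓝[≥] x, h y ≠ 0 := (hc x).tendsto.eventually_ne hne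
  obtain ⟨u, hu, hsub⟩ := mem_nhdsGE_iff_exists_Ico_subset.1 e
  have h0 : p.mV (Ico x (min u 1)) = 0 := by
    rw [ae_iff, μV_eq, Measure.restrict_apply' measurableSet_Ico] at hae
    refine measure_mono_null (fun y hy => ?_) hae
    exact ⟨hsub ⟨hy.1, hy.2.trans_le (min_le_left _ _)⟩, hx.1.trans hy.1,
      hy.2.trans_le (min_le_right _ _)⟩
  have hlt : x < min u 1 := lt_min hu hx.2
  have h1 := p.mV_real_Ico x (min u 1) hlt.le
  rw [Measure.real, h0, ENNReal.toReal_zero] at h1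
  linarith [p.strictMono_V hlt]

theorem eq_zero_of_ae_μW {h : ℝ → ℝ} (hc : ∀ x, ContinuousWithinAt h (Iic x) x)
    (hae : ∀ᵐ x ∂p.μW, h x = 0) {x : ℝ} (hx : x ∈ Ioc (0 : ℝ) 1) : h x = 0 := by
  by_contra hne
  have e : ∀ᶠ y in 𝓝[≤] x, h y ≠ 0 := (hc x).tendsto.eventually_ne hne
  obtain ⟨l, hl, hsub⟩ := mem_nhdsLE_iff_exists_Ioc_subset.1 e
  have h0 : p.mW (Ioc (max l 0) x) = 0 := by
    rw [ae_iff, μW_eq, Measure.restrict_apply' measurableSet_Ioc] at hae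
    refine measure_mono_null (fun y hy => ?_) hae
    exact ⟨hsub ⟨(le_max_left _ _).trans_lt hy.1, hy.2⟩, (le_max_right _ _).trans_lt hy.1,
      hy.2.trans hx.2⟩
  have hlt : max l 0 < x := max_lt hl hx.1
  have h1 := p.mW_real_Ioc (max l 0) x hlt.le
  rw [Measure.real, h0, ENNReal.toReal_zero] at h1
  linarith [p.strictMono_W hlt]

/-! ### The classical domain -/

theorem leftD_eq {W f : ℝ → ℝ} {x l : ℝ}
    (h : Tendsto (fun y => (f y - f x) / (W y - W x)) (𝓝[<] x) (𝓝 l)) : leftD W f x = l :=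
  h.limUnder_eq

theorem rightD_eq {V f : ℝ → ℝ} {x l : ℝ}
    (h : Tendsto (fun y => (f y - f x) / (V y - V x)) (𝓝[>] x) (𝓝 l)) : rightD V f x = l :=
  h.limUnder_eq

theorem tendsto_leftD {W f : ℝ → ℝ} (h : LeftDifferentiable W f) (x : ℝ) :
    Tendsto (fun y => (f y - f x) / (W y - W x)) (𝓝[<] x) (𝓝 (leftD W f x)) :=
  tendsto_nhds_limUnder (h x)

theorem tendsto_rightD {V f : ℝ → ℝ} (h : RightDifferentiable V f) (x : ℝ) :
    Tendsto (fun y => (f y - f x) / (V y - V x)) (𝓝[>] x) (𝓝 (rightD V f x)) :=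
  tendsto_nhds_limUnder (h x)

theorem leftD_sub {W f g : ℝ → ℝ} (hf : LeftDifferentiable W f) (hg : LeftDifferentiable W g) :
    LeftDifferentiable W (fun x => f x - g x) ∧
      leftD W (fun x => f x - g x) = fun x => leftD W f x - leftD W g x := by
  have h : ∀ x, Tendsto (fun y => ((f y - g y) - (f x - g x)) / (W y - W x)) (𝓝[<] x)
      (𝓝 (leftD W f x - leftD W g x)) := fun x =>
    ((tendsto_leftD hf x).sub (tendsto_leftD hg x)).congr fun y => by
      rw [← sub_div]; congr 1; ring
  exact ⟨fun x => ⟨_, h x⟩, funext fun x => leftD_eq (h x)⟩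

theorem rightD_sub {V f g : ℝ → ℝ} (hf : RightDifferentiable V f) (hg : RightDifferentiable V g) :
    RightDifferentiable V (fun x => f x - g x) ∧
      rightD V (fun x => f x - g x) = fun x => rightD V f x - rightD V g x := by
  have h : ∀ x, Tendsto (fun y => ((f y - g y) - (f x - g x)) / (V y - V x)) (𝓝[>] x)
      (𝓝 (rightD V f x - rightD V g x)) := fun x =>
    ((tendsto_rightD hf x).sub (tendsto_rightD hg x)).congr fun y => by
      rw [← sub_div]; congr 1; ring
  exact ⟨fun x => ⟨_, h x⟩, funext fun x => rightD_eq (h x)⟩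

theorem W_add_one_sub (x y : ℝ) : p.W (y + 1) - p.W (x + 1) = p.W y - p.W x := by
  linarith [p.periodic_W x, p.periodic_W y]

theorem V_add_one_sub (x y : ℝ) : p.V (y + 1) - p.V (x + 1) = p.V y - p.V x := by
  linarith [p.periodic_V x, p.periodic_V y]

theorem periodic_leftD {f : ℝ → ℝ} (hper : Function.Periodic f 1)
    (hf : LeftDifferentiable p.W f) : Function.Periodic (leftD p.W f) 1 := by
  intro x
  refine tendsto_nhds_unique ?_ (tendsto_leftD hf x)
  refine ((tendsto_leftD hf (x + 1)).comp (tendsto_add_one_nhdsLT x)).congr fun y => ?_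
  simp only [Function.comp, hper y, hper x, W_add_one_sub]

theorem strongDomain_sub {f g : ℝ → ℝ} (hf : f ∈ p.strongDomain) (hg : g ∈ p.strongDomain) :
    (fun x => f x - g x) ∈ p.strongDomain ∧
      leftD p.W (fun x => f x - g x) = fun x => leftD p.W f x - leftD p.W g x := by
  obtain ⟨f1, f2, f3, f4, f5, f6⟩ := hf
  obtain ⟨g1, g2, g3, g4, g5, g6⟩ := hg
  obtain ⟨h1, h2⟩ := leftD_sub f3 g3
  obtain ⟨h3, h4⟩ := rightD_sub f5 g5
  refine ⟨⟨fun x => by simp only [f1 x, g1 x], f2.sub g2, h1, ?_, ?_, ?_⟩, h2⟩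
  · rw [h2]; exact f4.sub g4
  · rw [h2]; exact h3
  · rw [h2, h4]; exact f6.sub g6

theorem strongDomain_sub_eq {f : ℝ → ℝ} (hf : f ∈ p.strongDomain) (a b : ℝ) (hab : a ≤ b) :
    f b - f a = ∫ s in Ioc a b, leftD p.W f s ∂p.mW :=
  sub_eq_setIntegral_of_leftQuotient p.strictMono_W (fun x => (p.cadlag_W x).1) p.mW_real_Ioc
    (fun x => (hf.2.1 x).1) hf.2.2.2.1 (tendsto_leftD hf.2.2.1) a b hab

theorem strongDomain_leftD_sub_eq {f : ℝ → ℝ} (hf : f ∈ p.strongDomain) (a b : ℝ) (hab : a ≤ b) :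
    leftD p.W f b - leftD p.W f a = ∫ s in Ico a b, rightD p.V (leftD p.W f) s ∂p.mV :=
  sub_eq_setIntegral_of_rightQuotient p.strictMono_V (fun x => (p.caglad_V x).1) p.mV_real_Ico
    (fun x => (hf.2.2.2.1 x).1) hf.2.2.2.2.2 (tendsto_rightD hf.2.2.2.2.1) a b hab

theorem integral_leftD_eq_zero {f : ℝ → ℝ} (hf : f ∈ p.strongDomain) :
    ∫ s, leftD p.W f s ∂p.μW = 0 := by
  rw [integral_μW, ← strongDomain_sub_eq hf 0 1 zero_le_one]
  simpa [sub_eq_zero] using hf.1 0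

theorem integral_rightD_eq_zero {f : ℝ → ℝ} (hf : f ∈ p.strongDomain) :
    ∫ s, rightD p.V (leftD p.W f) s ∂p.μV = 0 := by
  rw [integral_μV, ← strongDomain_leftD_sub_eq hf 0 1 zero_le_one]
  simpa [sub_eq_zero] using periodic_leftD hf.1 hf.2.2.1 0

theorem strongDomain_eq_primitive {f : ℝ → ℝ} (hf : f ∈ p.strongDomain) {x : ℝ}
    (hx : x ∈ Icc (0 : ℝ) 1) : f x = f 0 + ∫ s in Iic x, leftD p.W f s ∂p.μW := by
  rw [setIntegral_Iic_μW _ _ hx.2, ← strongDomain_sub_eq hf 0 x hx.1]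
  ring

theorem leftD_eq_primitive {f : ℝ → ℝ} (hf : f ∈ p.strongDomain) {x : ℝ}
    (hx : x ∈ Icc (0 : ℝ) 1) :
    leftD p.W f x = leftD p.W f 1 - ∫ s in Ici x, rightD p.V (leftD p.W f) s ∂p.μV := by
  rw [setIntegral_Ici_μV _ _ hx.1, ← strongDomain_leftD_sub_eq hf x 1 hx.2]
  ring

/-- Every periodic càdlàg `φ` of `V`-mean zero is `D⁺_V D⁻_W f` for some `f` in the classical
domain, and the value of `f` at the origin can be prescribed. -/
theorem exists_strongDomain {φ : ℝ → ℝ} (hφ : IsCadlag φ) (hper : Function.Periodic φ 1)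
    (hint : ∫ s, φ s ∂p.μV = 0) (c : ℝ) :
    ∃ f ∈ p.strongDomain, f 0 = c ∧ rightD p.V (leftD p.W f) = φ := by
  have hφi : ∀ a b, IntegrableOn φ (Icc a b) p.mV := hφ.integrableOn
  obtain ⟨k, -, hk⟩ := exists_sub_eq_setIntegral_Ico hφi 0
  have hkc := isCaglad_of_sub_eq_setIntegral_Ico hφi hk
  -- Normalize the primitive `k` of `φ` to `W`-mean zero.
  set C : ℝ := (∫ s, k s ∂p.μW) / p.μW.real univ with hC
  set g : ℝ → ℝ := fun x => k x - C with hg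
  have hgc : IsCaglad g := hkc.sub (isCaglad_const C)
  have hgk : ∀ a b, a ≤ b → g b - g a = ∫ s in Ico a b, φ s ∂p.mV := by
    intro a b hab
    rw [← hk a b hab, hg]
    ring
  have hgd : ∀ x, Tendsto (fun y => (g y - g x) / (p.V y - p.V x)) (𝓝[>] x) (𝓝 (φ x)) :=
    fun x => tendsto_rightQuotient p.strictMono_V p.mV_real_Ico hφi hgk (hφ x).1
  have hgint : ∫ s, g s ∂p.μW = 0 := by
    have hki : Integrable k p.μW := (hkc.integrableOn 0 1).mono_set Ioc_subset_Icc_self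
    rw [hg, integral_sub hki (integrable_const _), integral_const, smul_eq_mul, hC,
      mul_div_cancel₀ _ p.μW_real_univ_pos.ne', sub_self]
  have hgper : Function.Periodic g 1 := by
    have h0 : ∀ x, g (x + 1) - g x = g (0 + 1) - g 0 := fun x =>
      eq_of_rightQuotient_tendsto_zero (h := fun x => g (x + 1) - g x) p.strictMono_V
        (fun x => (p.caglad_V x).1) (fun x => ((hgc.comp_add_const 1).sub hgc x).1)
        (fun x => by
          have h1 := ((hgd (x + 1)).comp (tendsto_add_one_nhdsGT x)).sub (hgd x)
          rw [hper x, sub_self] at h1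
          refine h1.congr fun y => ?_
          simp only [Function.comp, V_add_one_sub]
          rw [← sub_div]
          congr 1
          ring) x 0
    intro x
    have h1 := h0 x
    rw [zero_add, hgk 0 1 zero_le_one, ← integral_μV, hint] at h1
    linarith
  have hgi : ∀ a b, IntegrableOn g (Icc a b) p.mW := hgc.integrableOn
  obtain ⟨f, hf0, hf⟩ := exists_sub_eq_setIntegral_Ioc hgi c
  have hfc := isCadlag_of_sub_eq_setIntegral_Ioc hgi hf
  have hfd : ∀ x, Tendsto (fun y => (f y - f x) / (p.W y - p.W x)) (𝓝[<] x) (𝓝 (g x)) :=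
    fun x => tendsto_leftQuotient p.strictMono_W p.mW_real_Ioc hgi hf (hgc x).1
  have hfper : Function.Periodic f 1 := by
    have h0 : ∀ x, f (x + 1) - f x = f (0 + 1) - f 0 := fun x =>
      eq_of_leftQuotient_tendsto_zero (h := fun x => f (x + 1) - f x) p.strictMono_W
        (fun x => (p.cadlag_W x).1) (fun x => ((hfc.comp_add_const 1).sub hfc x).1)
        (fun x => by
          have h1 := ((hfd (x + 1)).comp (tendsto_add_one_nhdsLT x)).sub (hfd x)
          rw [hgper x, sub_self] at h1
          refine h1.congr fun y => ?_
          simp only [Function.comp, W_add_one_sub]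
          rw [← sub_div]
          congr 1
          ring) x 0
    intro x
    have h1 := h0 x
    rw [zero_add, hf 0 1 zero_le_one, ← integral_μW, hgint] at h1
    linarith
  have hL : leftD p.W f = g := funext fun x => leftD_eq (hfd x)
  have hR : rightD p.V (leftD p.W f) = φ := by
    rw [hL]
    exact funext fun x => rightD_eq (hgd x)
  refine ⟨f, ⟨hfper, hfc, fun x => ⟨_, hfd x⟩, ?_, ?_, ?_⟩, hf0, hR⟩
  · rw [hL]; exact hgc
  · rw [hL]; exact fun x => ⟨_, hgd x⟩
  · rw [hR]; exact hφ

end WeightPair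

/-! ### Integral operators on `L²` -/

section HilbertSchmidt

variable {X : Type*} [NormedAddCommGroup X] [InnerProductSpace ℝ X]
  {Ω : Type*} [MeasurableSpace Ω]

/-- The operator `X → L²(ν)` with square integrable kernel `κ : Ω → X`, that is
`F ↦ (ω ↦ ⟨F, κ ω⟩)`, as a continuous function of `κ`. -/
def kernelOperator (X : Type*) [NormedAddCommGroup X] [InnerProductSpace ℝ X] (ν : Measure Ω) :
    Lp X 2 ν →L[ℝ] X →L[ℝ] Lp ℝ 2 ν :=
  (ContinuousLinearMap.compLpL₂ 2 ν
    (isBoundedBilinearMap_inner (𝕜 := ℝ) (E := X)).toContinuousLinearMap).flip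

theorem coeFn_kernelOperator {ν : Measure Ω} (κ : Lp X 2 ν) (F : X) :
    kernelOperator X ν κ F =ᵐ[ν] fun ω => inner ℝ F (κ ω) :=
  ContinuousLinearMap.coeFn_compLp _ κ

/-- Operators with a square integrable kernel are compact: a simple kernel gives an operator of
finite rank, and simple kernels are dense. -/
theorem isCompactOperator_kernelOperator {ν : Measure Ω} (κ : Lp X 2 ν) :
    IsCompactOperator (kernelOperator X ν κ) := by
  refine Lp.induction (p := 2) ENNReal.ofNat_ne_top
    (motive := fun κ => IsCompactOperator (kernelOperator X ν κ)) ?_ ?_ ?_ κ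
  · intro c s hs hμs
    have h : kernelOperator X ν (Lp.simpleFunc.indicatorConst 2 hs hμs.ne c) =
        (innerSL ℝ c).smulRight (indicatorConstLp 2 hs hμs.ne (1 : ℝ)) := by
      ext1 F
      refine Lp.ext ?_
      rw [Lp.simpleFunc.coe_indicatorConst, ContinuousLinearMap.smulRight_apply]
      filter_upwards [coeFn_kernelOperator (indicatorConstLp 2 hs hμs.ne c) F,
        Lp.coeFn_smul (innerSL ℝ c F) (indicatorConstLp 2 hs hμs.ne (1 : ℝ)),
        indicatorConstLp_coeFn (p := 2) (hs := hs) (hμs := hμs.ne) (c := c),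
        indicatorConstLp_coeFn (p := 2) (hs := hs) (hμs := hμs.ne) (c := (1 : ℝ))]
        with x h1 h2 h3 h4
      rw [h1, h2, Pi.smul_apply, h3, h4]
      by_cases hx : x ∈ s
      · simp [indicator_of_mem hx, real_inner_comm]
      · simp [indicator_of_notMem hx]
    rw [h]
    exact (isCompactOperator_of_locallyCompactSpace_rng
      (ContinuousLinearMap.toSpanSingleton ℝ (indicatorConstLp 2 hs hμs.ne (1 : ℝ)))).comp_clm
        (innerSL ℝ c)
  · intro f g hf hg _ h1 h2
    rw [map_add]
    exact h1.add h2
  · exact isClosed_setOfPred_isCompactOperator.preimage (kernelOperator X ν).continuous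

end HilbertSchmidt

/-! ### The Volterra operator -/

section Volterra

variable (μ ν : Measure ℝ) [IsFiniteMeasure μ] [IsFiniteMeasure ν]

/-- The indicator function of `(-∞, x]` as an element of `L²(μ)`. -/
def halfLine (x : ℝ) : Lp ℝ 2 μ :=
  indicatorConstLp 2 (measurableSet_Iic (a := x)) (measure_ne_top μ _) (1 : ℝ)

theorem inner_halfLine (F : Lp ℝ 2 μ) (x : ℝ) :
    inner ℝ F (halfLine μ x) = ∫ s in Iic x, F s ∂μ := by
  rw [real_inner_comm, halfLine, L2.inner_indicatorConstLp_one]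

theorem continuousWithinAt_halfLine (x : ℝ) : ContinuousWithinAt (halfLine μ) (Ici x) x := by
  refine tendsto_indicatorConstLp_set (by norm_num) ?_
  have hm : ∀ y : ℝ, MeasurableSet (symmDiff (Iic y) (Iic x)) := fun y =>
    measurableSet_Iic.symmDiff measurableSet_Iic
  have h := tendsto_setIntegral_of_eventually_mem_iff (m := μ) (l := 𝓝[≥] x)
    (S := fun y => symmDiff (Iic y) (Iic x)) (A := ∅) (integrable_const (1 : ℝ)) hm
    MeasurableSet.empty (fun s => ?_)
  · simp only [setIntegral_const, smul_eq_mul, mul_one] at h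
    have h2 := ENNReal.tendsto_ofReal h
    simpa using h2
  · rcases le_or_gt s x with h | h
    · filter_upwards [self_mem_nhdsWithin] with y hy
      simp [mem_symmDiff, h, h.trans hy]
    · filter_upwards [mem_nhdsWithin_of_mem_nhds (Iio_mem_nhds h)] with y hy
      simp [mem_symmDiff, h, mem_Iio.1 hy]

theorem memLp_halfLine : MemLp (halfLine μ) 2 ν := by
  refine MemLp.of_bound (C := μ.real univ ^ (1 / (2 : ENNReal).toReal))
    (stronglyMeasurable_of_continuousWithinAt_Ici
      (continuousWithinAt_halfLine μ)).aestronglyMeasurable (Eventually.of_forall fun x => ?_)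
  rw [halfLine, norm_indicatorConstLp (by norm_num) (by norm_num), norm_one, one_mul]
  exact Real.rpow_le_rpow measureReal_nonneg (measureReal_mono (subset_univ _)) (by norm_num)

/-- The operator `F ↦ (x ↦ ∫_{(-∞, x]} F dμ)` from `L²(μ)` to `L²(ν)`. -/
def volterra : Lp ℝ 2 μ →L[ℝ] Lp ℝ 2 ν :=
  kernelOperator (Lp ℝ 2 μ) ν ((memLp_halfLine μ ν).toLp _)

theorem isCompactOperator_volterra : IsCompactOperator (volterra μ ν) :=
  isCompactOperator_kernelOperator _

theorem coeFn_volterra (F : Lp ℝ 2 μ) :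
    volterra μ ν F =ᵐ[ν] fun x => ∫ s in Iic x, F s ∂μ := by
  filter_upwards [coeFn_kernelOperator ((memLp_halfLine μ ν).toLp _) F,
    (memLp_halfLine μ ν).coeFn_toLp] with x h1 h2
  rw [volterra, h1, h2, inner_halfLine]

theorem integrable_of_Lp_two {μ : Measure ℝ} [IsFiniteMeasure μ] (F : Lp ℝ 2 μ) : Integrable F μ :=
  (Lp.memLp F).integrable (by norm_num)

theorem coeFn_adjoint_volterra (u : Lp ℝ 2 ν) :
    (volterra μ ν).adjoint u =ᵐ[μ] fun s => ∫ x in Ici s, u x ∂ν := by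
  have hu := integrable_of_Lp_two u
  have hU : MemLp (fun s => ∫ x in Ici s, u x ∂ν) 2 μ := by
    refine MemLp.of_bound (C := ∫ x, ‖u x‖ ∂ν)
      (isCaglad_setIntegral_Ici hu).measurable.aestronglyMeasurable
      (Eventually.of_forall fun s => ?_)
    exact (norm_integral_le_integral_norm _).trans
      (setIntegral_le_integral hu.norm (Eventually.of_forall fun x => norm_nonneg _))
  have h : (volterra μ ν).adjoint u = hU.toLp _ := by
    refine ext_inner_left ℝ fun F => ?_
    have hF := integrable_of_Lp_two F
    rw [ContinuousLinearMap.adjoint_inner_right, L2.inner_def, L2.inner_def]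
    have hint : Integrable (Function.uncurry fun x s => (Iic x).indicator (fun s => F s * u x) s)
        (ν.prod μ) := by
      have h1 : Integrable (fun z : ℝ × ℝ => u z.1 * F z.2) (ν.prod μ) := hu.mul_prod hF
      have h2 : MeasurableSet {z : ℝ × ℝ | z.2 ≤ z.1} :=
        measurableSet_le measurable_snd measurable_fst
      refine (h1.indicator h2).congr (Eventually.of_forall fun z => ?_)
      simp only [Function.uncurry, indicator_apply, mem_ofPred_eq, mem_Iic, mul_comm]
    calc ∫ x, inner ℝ (volterra μ ν F x) (u x) ∂ν
        = ∫ x, ∫ s, (Iic x).indicator (fun s => F s * u x) s ∂μ ∂ν := by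
          refine integral_congr_ae ?_
          filter_upwards [coeFn_volterra μ ν F] with x hx
          rw [hx, integral_indicator measurableSet_Iic, integral_mul_const]
          simp [mul_comm]
      _ = ∫ s, ∫ x, (Iic x).indicator (fun s => F s * u x) s ∂ν ∂μ :=
          integral_integral_swap hint
      _ = ∫ s, inner ℝ (F s) (hU.toLp _ s) ∂μ := by
          refine integral_congr_ae ?_
          filter_upwards [hU.coeFn_toLp] with s hs
          rw [hs, ← integral_indicator measurableSet_Ici]
          simp only [RCLike.inner_apply, conj_trivial]
          rw [mul_comm, ← integral_const_mul]
          refine integral_congr_ae (Eventually.of_forall fun x => ?_)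
          simp only [indicator_apply, mem_Iic, mem_Ici]
          split_ifs <;> simp
  rw [h]
  exact hU.coeFn_toLp

end Volterra

/-! ### Projection off a vector -/

section Projection

variable {X : Type*} [NormedAddCommGroup X] [InnerProductSpace ℝ X]

theorem exists_starProjection_orthogonal_eq (e f : X) :
    ∃ c : ℝ, (ℝ ∙ e)ᗮ.starProjection f = f - c • e := by
  have h : f - (ℝ ∙ e)ᗮ.starProjection f ∈ (ℝ ∙ e)ᗮᗮ :=
    Submodule.sub_starProjection_mem_orthogonal f
  rw [Submodule.orthogonal_orthogonal, Submodule.mem_span_singleton] at h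
  obtain ⟨c, hc⟩ := h
  exact ⟨c, by rw [hc, sub_sub_cancel]⟩

theorem starProjection_orthogonal_eq_self {e f : X} (h : inner ℝ e f = 0) :
    (ℝ ∙ e)ᗮ.starProjection f = f :=
  Submodule.starProjection_eq_self_iff.2 (Submodule.mem_orthogonal_singleton_iff_inner_right.2 h)

theorem inner_starProjection_orthogonal (e f : X) :
    inner ℝ e ((ℝ ∙ e)ᗮ.starProjection f) = 0 :=
  Submodule.mem_orthogonal_singleton_iff_inner_right.1 (Submodule.starProjection_apply_mem _ _)

theorem starProjection_orthogonal_self (e : X) : (ℝ ∙ e)ᗮ.starProjection e = 0 := by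
  obtain ⟨c, hc⟩ := exists_starProjection_orthogonal_eq e e
  have h := inner_starProjection_orthogonal e e
  rw [← inner_self_eq_zero (𝕜 := ℝ)]
  nth_rewrite 1 [hc]
  rw [inner_sub_left, real_inner_smul_left, h, mul_zero, sub_zero]

end Projection

namespace WeightPair

variable (p : WeightPair)

/-! ### The primitive operator on the circle -/

/-- The constant function `1` in `L²_W(𝕋)`. -/
def oneW : p.L2W := Lp.const 2 p.μW 1

/-- The constant function `1` in `L²_V(𝕋)`. -/
def oneV : p.L2V := Lp.const 2 p.μV 1

theorem coeFn_oneW : p.oneW =ᵐ[p.μW] fun _ => 1 := Lp.coeFn_const 2 _ 1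

theorem coeFn_oneV : p.oneV =ᵐ[p.μV] fun _ => 1 := Lp.coeFn_const 2 _ 1

theorem const_eq_smul_oneV (c : ℝ) : Lp.const 2 p.μV c = c • p.oneV := by
  have h := (Lp.constL 2 p.μV ℝ).map_smul c (1 : ℝ)
  rwa [smul_eq_mul, mul_one] at h

theorem inner_oneW (F : p.L2W) : inner ℝ p.oneW F = ∫ s, F s ∂p.μW := by
  rw [oneW, ← indicatorConstLp_univ, L2.inner_indicatorConstLp_one, Measure.restrict_univ]

theorem inner_oneV (u : p.L2V) : inner ℝ p.oneV u = ∫ s, u s ∂p.μV := by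
  rw [oneV, ← indicatorConstLp_univ, L2.inner_indicatorConstLp_one, Measure.restrict_univ]

theorem oneV_ne_zero : p.oneV ≠ 0 := by
  intro h
  have h1 := p.inner_oneV p.oneV
  rw [integral_congr_ae p.coeFn_oneV, integral_const, smul_eq_mul, mul_one, h,
    inner_zero_left] at h1
  exact p.μV_real_univ_pos.ne h1

/-- The operator taking `F ∈ L²_W(𝕋)`, made mean zero, to its mean zero primitive in `L²_V(𝕋)`. -/
def primitive : p.L2W →L[ℝ] p.L2V :=
  (ℝ ∙ p.oneV)ᗮ.starProjection ∘L volterra p.μW p.μV ∘L (ℝ ∙ p.oneW)ᗮ.starProjection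

theorem isCompactOperator_primitive : IsCompactOperator p.primitive := by
  have h : (p.primitive : p.L2W → p.L2V) = (ℝ ∙ p.oneV)ᗮ.starProjection ∘
      (volterra p.μW p.μV ∘ (ℝ ∙ p.oneW)ᗮ.starProjection) := rfl
  rw [h]
  exact ((isCompactOperator_volterra p.μW p.μV).comp_clm _).clm_comp _

theorem primitive_apply {F : p.L2W} (hF : inner ℝ p.oneW F = 0) :
    p.primitive F = (ℝ ∙ p.oneV)ᗮ.starProjection (volterra p.μW p.μV F) := by
  change (ℝ ∙ p.oneV)ᗮ.starProjection
    (volterra p.μW p.μV ((ℝ ∙ p.oneW)ᗮ.starProjection F)) = _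
  rw [starProjection_orthogonal_eq_self hF]

theorem exists_primitive_eq {F : p.L2W} (hF : inner ℝ p.oneW F = 0) :
    ∃ c : ℝ, p.primitive F = volterra p.μW p.μV F - c • p.oneV := by
  rw [primitive_apply p hF]
  exact exists_starProjection_orthogonal_eq _ _

theorem adjoint_primitive_apply (u : p.L2V) : p.primitive.adjoint u =
    (ℝ ∙ p.oneW)ᗮ.starProjection ((volterra p.μW p.μV).adjoint
      ((ℝ ∙ p.oneV)ᗮ.starProjection u)) := by
  refine ext_inner_left ℝ fun F => ?_
  rw [ContinuousLinearMap.adjoint_inner_right, ← Submodule.inner_starProjection_left_eq_right,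
    ContinuousLinearMap.adjoint_inner_right, ← Submodule.inner_starProjection_left_eq_right]
  rfl

theorem primitive_oneW : p.primitive p.oneW = 0 := by
  change (ℝ ∙ p.oneV)ᗮ.starProjection
    (volterra p.μW p.μV ((ℝ ∙ p.oneW)ᗮ.starProjection p.oneW)) = _
  rw [starProjection_orthogonal_self, map_zero, map_zero]

theorem adjoint_primitive_oneV : p.primitive.adjoint p.oneV = 0 := by
  rw [adjoint_primitive_apply, starProjection_orthogonal_self, map_zero, map_zero]

theorem setIntegral_Iic_μW_of_nonpos (F : ℝ → ℝ) {x : ℝ} (hx : x ≤ 0) :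
    ∫ s in Iic x, F s ∂p.μW = 0 := by
  rw [setIntegral_Iic_μW _ _ (hx.trans zero_le_one), Ioc_eq_empty_of_le hx, setIntegral_empty]

theorem setIntegral_Iic_μW_of_one_le (F : ℝ → ℝ) {x : ℝ} (hx : 1 ≤ x) :
    ∫ s in Iic x, F s ∂p.μW = ∫ s, F s ∂p.μW := by
  rw [← setIntegral_Ioc_μW, μW_eq, Measure.restrict_restrict measurableSet_Ioc,
    inter_eq_self_of_subset_right (Ioc_subset_Ioc_right hx)]

theorem setIntegral_Ici_μV_of_one_le (F : ℝ → ℝ) {x : ℝ} (hx : 1 ≤ x) :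
    ∫ s in Ici x, F s ∂p.μV = 0 := by
  rw [setIntegral_Ici_μV _ _ (zero_le_one.trans hx), Ico_eq_empty_of_le hx, setIntegral_empty]

theorem setIntegral_Ici_μV_of_nonpos (F : ℝ → ℝ) {x : ℝ} (hx : x ≤ 0) :
    ∫ s in Ici x, F s ∂p.μV = ∫ s, F s ∂p.μV := by
  rw [μV_eq, Measure.restrict_restrict measurableSet_Ici, inter_eq_self_of_subset_right]
  exact fun y hy => hx.trans hy.1

/-- The kernel of the primitive operator consists of the constants: a primitive is càdlàg and `μV`
charges every interval, so a primitive that is constant almost everywhere is constant. -/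
theorem exists_smul_eq_of_primitive_eq_zero (F : p.L2W) (h : p.primitive F = 0) :
    ∃ c : ℝ, F = c • p.oneW := by
  obtain ⟨d, hd⟩ := exists_starProjection_orthogonal_eq p.oneW F
  set F₀ := (ℝ ∙ p.oneW)ᗮ.starProjection F
  have hF₀ : inner ℝ p.oneW F₀ = 0 := inner_starProjection_orthogonal _ _
  have hP : p.primitive F₀ = 0 := by
    rw [hd, map_sub, map_smul, primitive_oneW, h, smul_zero, sub_zero]
  obtain ⟨c, hc⟩ := p.exists_primitive_eq hF₀
  rw [hP] at hc
  have hint := integrable_of_Lp_two F₀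
  have hae : ∀ᵐ x ∂p.μV, (∫ s in Iic x, F₀ s ∂p.μW) - c = 0 := by
    have h1 : volterra p.μW p.μV F₀ = c • p.oneV := (sub_eq_zero.1 hc.symm)
    have h2 := coeFn_volterra p.μW p.μV F₀
    rw [h1] at h2
    filter_upwards [h2, Lp.coeFn_smul c p.oneV, p.coeFn_oneV] with x h3 h4 h5
    rw [← h3, h4, Pi.smul_apply, h5, smul_eq_mul, mul_one, sub_self]
  have hz : ∀ x ∈ Ico (0 : ℝ) 1, (∫ s in Iic x, F₀ s ∂p.μW) - c = 0 := fun x hx =>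
    eq_zero_of_ae_μV (fun x => ((isCadlag_setIntegral_Iic hint).sub (isCadlag_const c) x).1) hae hx
  have hc0 : c = 0 := by
    have := hz 0 ⟨le_rfl, zero_lt_one⟩
    rw [p.setIntegral_Iic_μW_of_nonpos _ le_rfl] at this
    linarith
  have huniv : ∫ s, F₀ s ∂p.μW = 0 := by rw [← inner_oneW, hF₀]
  have h0 : F₀ =ᵐ[p.μW] 0 := by
    refine ae_eq_zero_of_setIntegral_piSystem
      ((BorelSpace.measurable_eq (α := ℝ)).trans (borel_eq_generateFrom_Iic ℝ)) isPiSystem_Iic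
      hint huniv ?_
    rintro _ ⟨x, rfl⟩
    rcases le_or_gt x 0 with hx | hx
    · exact p.setIntegral_Iic_μW_of_nonpos _ hx
    · rcases le_or_gt 1 x with hx1 | hx1
      · rw [p.setIntegral_Iic_μW_of_one_le _ hx1, huniv]
      · have := hz x ⟨hx.le, hx1⟩
        linarith
  have h1 : F₀ = 0 := (Lp.eq_zero_iff_ae_eq_zero).2 h0
  exact ⟨d, sub_eq_zero.1 (hd.symm.trans h1)⟩

theorem exists_smul_eq_of_adjoint_primitive_eq_zero (u : p.L2V) (h : p.primitive.adjoint u = 0) :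
    ∃ c : ℝ, u = c • p.oneV := by
  obtain ⟨d, hd⟩ := exists_starProjection_orthogonal_eq p.oneV u
  rw [adjoint_primitive_apply] at h
  set u₀ := (ℝ ∙ p.oneV)ᗮ.starProjection u
  have hu₀ : inner ℝ p.oneV u₀ = 0 := inner_starProjection_orthogonal _ _
  obtain ⟨c, hc⟩ := exists_starProjection_orthogonal_eq p.oneW ((volterra p.μW p.μV).adjoint u₀)
  rw [h] at hc
  have hint := integrable_of_Lp_two u₀
  have hae : ∀ᵐ s ∂p.μW, (∫ x in Ici s, u₀ x ∂p.μV) - c = 0 := by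
    have h1 : (volterra p.μW p.μV).adjoint u₀ = c • p.oneW := (sub_eq_zero.1 hc.symm)
    have h2 := coeFn_adjoint_volterra p.μW p.μV u₀
    rw [h1] at h2
    filter_upwards [h2, Lp.coeFn_smul c p.oneW, p.coeFn_oneW] with x h3 h4 h5
    rw [← h3, h4, Pi.smul_apply, h5, smul_eq_mul, mul_one, sub_self]
  have hz : ∀ s ∈ Ioc (0 : ℝ) 1, (∫ x in Ici s, u₀ x ∂p.μV) - c = 0 := fun x hx =>
    eq_zero_of_ae_μW (fun x => ((isCaglad_setIntegral_Ici hint).sub (isCaglad_const c) x).1) hae hx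
  have hc0 : c = 0 := by
    have := hz 1 ⟨zero_lt_one, le_rfl⟩
    rw [p.setIntegral_Ici_μV_of_one_le _ le_rfl] at this
    linarith
  have huniv : ∫ x, u₀ x ∂p.μV = 0 := by rw [← inner_oneV, hu₀]
  have h0 : u₀ =ᵐ[p.μV] 0 := by
    refine ae_eq_zero_of_setIntegral_piSystem
      ((BorelSpace.measurable_eq (α := ℝ)).trans (borel_eq_generateFrom_Ici ℝ)) isPiSystem_Ici
      hint huniv ?_
    rintro _ ⟨x, rfl⟩
    rcases le_or_gt x 0 with hx | hx
    · rw [p.setIntegral_Ici_μV_of_nonpos _ hx, huniv]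
    · rcases le_or_gt 1 x with hx1 | hx1
      · exact p.setIntegral_Ici_μV_of_one_le _ hx1
      · have := hz x ⟨hx, hx1.le⟩
        linarith
  have h1 : u₀ = 0 := (Lp.eq_zero_iff_ae_eq_zero).2 h0
  exact ⟨d, sub_eq_zero.1 (hd.symm.trans h1)⟩

/-- Indicator functions of disjoint intervals are linearly independent, since `μV` charges each
interval. -/
theorem not_finiteDimensional_L2V : ¬ FiniteDimensional ℝ p.L2V := by
  intro hfin
  let t : ℕ → ℝ := fun n => 1 / ((n : ℝ) + 1)
  have ht : StrictAnti t := fun m n hmn => one_div_lt_one_div_of_lt (by positivity) (by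
    have : (m : ℝ) < n := by exact_mod_cast hmn
    linarith)
  let v : ℕ → p.L2V := fun n => indicatorConstLp 2 (measurableSet_Ico (a := t (n + 1)) (b := t n))
    (measure_ne_top p.μV _) (1 : ℝ)
  have hinner : ∀ i j, inner ℝ (v i) (v j) =
      p.μV.real (Ico (t (i + 1)) (t i) ∩ Ico (t (j + 1)) (t j)) := fun i j =>
    L2.real_inner_indicatorConstLp_one_indicatorConstLp_one _ _ _ _
  have hli : LinearIndependent ℝ v := by
    refine linearIndependent_of_ne_zero_of_inner_eq_zero (𝕜 := ℝ) (fun i hi => ?_)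
      fun i j hij => ?_
    · have h1 := hinner i i
      rw [hi, inner_zero_left, inter_self, μV_eq, measureReal_restrict_apply measurableSet_Ico,
        inter_eq_self_of_subset_left, mV_real_Ico _ _ _ (ht (Nat.lt_succ_self i)).le] at h1
      · linarith [p.strictMono_V (ht (Nat.lt_succ_self i))]
      · refine Ico_subset_Ico (by positivity) ?_
        have := ht.antitone (Nat.zero_le i)
        simpa [t] using this
    · have hdis : Ico (t (i + 1)) (t i) ∩ Ico (t (j + 1)) (t j) = ∅ := by
        rw [Ico_inter_Ico, Ico_eq_empty_iff, not_lt]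
        rcases lt_or_gt_of_ne hij with h | h
        · exact (inf_le_right.trans (ht.antitone (Nat.succ_le_of_lt h))).trans le_sup_left
        · exact (inf_le_left.trans (ht.antitone (Nat.succ_le_of_lt h))).trans le_sup_right
      change inner ℝ (v i) (v j) = 0
      rw [hinner, hdis, measureReal_empty]
  exact not_finite_iff_infinite.2 inferInstance (hli.finite (R := ℝ))

/-! ### Weak derivatives -/

variable {p}

theorem isSobolevDeriv_iff_volterra {f : p.L2V} {F : p.L2W} : p.IsSobolevDeriv f F ↔
    inner ℝ p.oneW F = 0 ∧ ∃ c : ℝ, f = volterra p.μW p.μV F + c • p.oneV := by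
  rw [IsSobolevDeriv, inner_oneW]
  refine and_congr_right fun _ => exists_congr fun c => ?_
  have h : (volterra p.μW p.μV F + c • p.oneV : p.L2V) =ᵐ[p.μV]
      fun x => c + ∫ s in Ioc 0 x, F s ∂p.μW := by
    filter_upwards [Lp.coeFn_add (volterra p.μW p.μV F) (c • p.oneV), Lp.coeFn_smul c p.oneV,
      p.coeFn_oneV, coeFn_volterra p.μW p.μV F] with x h1 h2 h3 h4
    rw [h1, Pi.add_apply, h2, Pi.smul_apply, h3, h4, setIntegral_Ioc_μW, smul_eq_mul, mul_one,
      add_comm]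
  constructor
  · intro hf
    refine Lp.ext ?_
    filter_upwards [hf, h] with x h1 h2
    rw [h1, h2]
  · rintro rfl
    exact h

/-- The additive constant absorbs the difference between the primitive and its mean zero part. -/
theorem isSobolevDeriv_iff {f : p.L2V} {F : p.L2W} :
    p.IsSobolevDeriv f F ↔ IsWeakDeriv p.primitive p.oneW p.oneV f F := by
  rw [isSobolevDeriv_iff_volterra, IsWeakDeriv]
  refine and_congr_right fun hF => ?_
  obtain ⟨d, hd⟩ := p.exists_primitive_eq hF
  rw [hd]
  constructor
  · rintro ⟨c, hc⟩
    exact ⟨c + d, by rw [hc, add_smul]; abel⟩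
  · rintro ⟨c, hc⟩
    exact ⟨c - d, by rw [hc, sub_smul]; abel⟩

theorem IsSobolevDeriv.unique {f : p.L2V} {F G : p.L2W} (hF : p.IsSobolevDeriv f F)
    (hG : p.IsSobolevDeriv f G) : F = G :=
  (isSobolevDeriv_iff.1 hF).unique p.exists_smul_eq_of_primitive_eq_zero p.adjoint_primitive_oneV
    (isSobolevDeriv_iff.1 hG)

theorem IsSobolevDeriv.sobolevDeriv_eq {f : p.L2V} {F : p.L2W} (hF : p.IsSobolevDeriv f F) :
    p.sobolevDeriv f = F := by
  have h : ∃ F, p.IsSobolevDeriv f F := ⟨F, hF⟩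
  rw [sobolevDeriv, dif_pos h]
  exact h.choose_spec.unique hF

/-! ### The energy form on the classical domain -/

theorem memLp_μV_of_isCadlag {f : ℝ → ℝ} (hf : IsCadlag f) : MemLp f 2 p.μV := by
  obtain ⟨C, hC⟩ := hf.bounded_Icc 0 1
  exact MemLp.of_bound hf.measurable.aestronglyMeasurable C
    (p.ae_mem_Ico_μV.mono fun x hx => hC x (Ico_subset_Icc_self hx))

theorem memLp_μW_of_isCaglad {f : ℝ → ℝ} (hf : IsCaglad f) : MemLp f 2 p.μW := by
  obtain ⟨C, hC⟩ := hf.bounded_Icc 0 1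
  exact MemLp.of_bound hf.measurable.aestronglyMeasurable C
    (p.ae_mem_Ioc_μW.mono fun x hx => hC x (Ioc_subset_Icc_self hx))

/-- The class in `L²_V(𝕋)` of a function in the classical domain. -/
def classV {f : ℝ → ℝ} (hf : f ∈ p.strongDomain) : p.L2V :=
  (memLp_μV_of_isCadlag hf.2.1).toLp f

/-- The class in `L²_W(𝕋)` of the left derivative of a function in the classical domain. -/
def derivW {f : ℝ → ℝ} (hf : f ∈ p.strongDomain) : p.L2W :=
  (memLp_μW_of_isCaglad hf.2.2.2.1).toLp (leftD p.W f)

/-- The class in `L²_V(𝕋)` of the second derivative of a function in the classical domain. -/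
def deriv₂V {f : ℝ → ℝ} (hf : f ∈ p.strongDomain) : p.L2V :=
  (memLp_μV_of_isCadlag hf.2.2.2.2.2).toLp (rightD p.V (leftD p.W f))

theorem coeFn_classV {f : ℝ → ℝ} (hf : f ∈ p.strongDomain) : classV hf =ᵐ[p.μV] f :=
  MemLp.coeFn_toLp _

theorem coeFn_derivW {f : ℝ → ℝ} (hf : f ∈ p.strongDomain) :
    derivW hf =ᵐ[p.μW] leftD p.W f :=
  MemLp.coeFn_toLp _

theorem coeFn_deriv₂V {f : ℝ → ℝ} (hf : f ∈ p.strongDomain) :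
    deriv₂V hf =ᵐ[p.μV] rightD p.V (leftD p.W f) :=
  MemLp.coeFn_toLp _

theorem inner_oneW_derivW {f : ℝ → ℝ} (hf : f ∈ p.strongDomain) :
    inner ℝ p.oneW (derivW hf) = 0 := by
  rw [inner_oneW, integral_congr_ae (coeFn_derivW hf), integral_leftD_eq_zero hf]

theorem inner_oneV_deriv₂V {f : ℝ → ℝ} (hf : f ∈ p.strongDomain) :
    inner ℝ p.oneV (deriv₂V hf) = 0 := by
  rw [inner_oneV, integral_congr_ae (coeFn_deriv₂V hf), integral_rightD_eq_zero hf]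

theorem classV_eq {f : ℝ → ℝ} (hf : f ∈ p.strongDomain) :
    classV hf = volterra p.μW p.μV (derivW hf) + f 0 • p.oneV := by
  refine Lp.ext ?_
  filter_upwards [coeFn_classV hf, Lp.coeFn_add (volterra p.μW p.μV (derivW hf)) (f 0 • p.oneV),
    Lp.coeFn_smul (f 0) p.oneV, p.coeFn_oneV, coeFn_volterra p.μW p.μV (derivW hf),
    p.ae_mem_Ico_μV] with x h0 h1 h2 h3 h4 hx
  rw [h0, h1, Pi.add_apply, h2, Pi.smul_apply, h3, h4, smul_eq_mul, mul_one,
    strongDomain_eq_primitive hf (Ico_subset_Icc_self hx), add_comm,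
    integral_congr_ae (ae_restrict_of_ae (coeFn_derivW hf))]

theorem isWeakDeriv_classV {f : ℝ → ℝ} (hf : f ∈ p.strongDomain) :
    IsWeakDeriv p.primitive p.oneW p.oneV (classV hf) (derivW hf) :=
  isSobolevDeriv_iff.1 (isSobolevDeriv_iff_volterra.2 ⟨inner_oneW_derivW hf, f 0, classV_eq hf⟩)

/-- Integration by parts: the first derivative is minus the adjoint primitive of the second. -/
theorem derivW_eq {f : ℝ → ℝ} (hf : f ∈ p.strongDomain) :
    derivW hf = -p.primitive.adjoint (deriv₂V hf) := by
  have h : derivW hf =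
      leftD p.W f 1 • p.oneW - (volterra p.μW p.μV).adjoint (deriv₂V hf) := by
    refine Lp.ext ?_
    filter_upwards [coeFn_derivW hf, Lp.coeFn_sub (leftD p.W f 1 • p.oneW)
      ((volterra p.μW p.μV).adjoint (deriv₂V hf)), Lp.coeFn_smul (leftD p.W f 1) p.oneW,
      p.coeFn_oneW, coeFn_adjoint_volterra p.μW p.μV (deriv₂V hf), p.ae_mem_Ioc_μW]
      with x h0 h1 h2 h3 h4 hx
    rw [h0, h1, Pi.sub_apply, h2, Pi.smul_apply, h3, h4, smul_eq_mul, mul_one,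
      leftD_eq_primitive hf (Ioc_subset_Icc_self hx),
      integral_congr_ae (ae_restrict_of_ae (coeFn_deriv₂V hf))]
  rw [adjoint_primitive_apply, starProjection_orthogonal_eq_self (inner_oneV_deriv₂V hf),
    ← starProjection_orthogonal_eq_self (inner_oneW_derivW hf)]
  nth_rewrite 1 [h]
  rw [map_sub, map_smul, starProjection_orthogonal_self, smul_zero, zero_sub]

theorem energyForm_eq {f g : ℝ → ℝ} (hf : f ∈ p.strongDomain) (hg : g ∈ p.strongDomain) :
    p.energyForm f g =
      inner ℝ (classV hf) (classV hg) + inner ℝ (derivW hf) (derivW hg) := by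
  have h1 : p.energyForm f g = inner ℝ (classV hf - deriv₂V hf) (classV hg) := by
    rw [energyForm, L2.inner_def]
    refine integral_congr_ae ?_
    filter_upwards [coeFn_classV hf, coeFn_classV hg, coeFn_deriv₂V hf,
      Lp.coeFn_sub (classV hf) (deriv₂V hf)] with x h1 h2 h3 h4
    rw [h4, Pi.sub_apply, h1, h2, h3]
    simp [mul_comm]
  obtain ⟨-, c, hc⟩ := isWeakDeriv_classV hg
  have h2 : inner ℝ (deriv₂V hf) (classV hg) = -inner ℝ (derivW hf) (derivW hg) := by
    rw [hc, inner_add_right, inner_smul_right, real_inner_comm p.oneV, inner_oneV_deriv₂V hf,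
      mul_zero, add_zero, derivW_eq hf, inner_neg_left, neg_neg,
      ContinuousLinearMap.adjoint_inner_left]
  rw [h1, inner_sub_left, h2, sub_neg_eq_add]

theorem energyNorm_sub {f g : ℝ → ℝ} (hf : f ∈ p.strongDomain) (hg : g ∈ p.strongDomain) :
    p.energyNorm (fun x => f x - g x) =
      √(‖classV hf - classV hg‖ ^ 2 + ‖derivW hf - derivW hg‖ ^ 2) := by
  obtain ⟨hs, hd⟩ := strongDomain_sub hf hg
  have h1 : classV hs = classV hf - classV hg := MemLp.toLp_sub _ _
  have h2 : derivW hs = derivW hf - derivW hg := by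
    refine Lp.ext ?_
    filter_upwards [coeFn_derivW hs, coeFn_derivW hf, coeFn_derivW hg,
      Lp.coeFn_sub (derivW hf) (derivW hg)] with x h3 h4 h5 h6
    rw [h3, h6, Pi.sub_apply, h4, h5, hd]
  rw [energyNorm, energyForm_eq hs hs, h1, h2, real_inner_self_eq_norm_sq,
    real_inner_self_eq_norm_sq]

/-! ### The energetic space -/

theorem tendsto_classV_iff {fn : ℕ → ℝ → ℝ} (hfn : ∀ n, fn n ∈ p.strongDomain) {f : p.L2V} :
    Tendsto (fun n => classV (hfn n)) atTop (𝓝 f) ↔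
      Tendsto (fun n => eLpNorm (fun x => fn n x - f x) 2 p.μV) atTop (𝓝 0) := by
  rw [Lp.tendsto_Lp_iff_tendsto_eLpNorm']
  refine tendsto_congr fun n => eLpNorm_congr_ae ?_
  filter_upwards [coeFn_classV (hfn n)] with x hx
  rw [Pi.sub_apply, hx]

/-- Along an admissible sequence the derivatives converge to the weak derivative of the limit. -/
theorem Admissible.exists_isWeakDeriv {fn : ℕ → ℝ → ℝ} {f : p.L2V} (h : p.Admissible fn f) :
    ∃ F, IsWeakDeriv p.primitive p.oneW p.oneV f F ∧
      Tendsto (fun n => classV (h.1 n)) atTop (𝓝 f) ∧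
      Tendsto (fun n => derivW (h.1 n)) atTop (𝓝 F) := by
  have hf := (tendsto_classV_iff h.1).2 h.2.1
  have hcau : CauchySeq fun n => derivW (h.1 n) := by
    refine Metric.cauchySeq_iff.2 fun ε hε => ?_
    obtain ⟨N, hN⟩ := h.2.2 ε hε
    refine ⟨N, fun m hm n hn => lt_of_le_of_lt ?_ (hN m hm n hn)⟩
    rw [energyNorm_sub (h.1 m) (h.1 n), dist_eq_norm]
    exact Real.le_sqrt_of_sq_le (le_add_of_nonneg_left (sq_nonneg _))
  obtain ⟨F, hF⟩ := cauchySeq_tendsto_of_complete hcau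
  have hF0 : inner ℝ p.oneW F = 0 := by
    refine tendsto_nhds_unique ((innerSL ℝ p.oneW).continuous.tendsto F |>.comp hF) ?_
    refine tendsto_const_nhds.congr fun n => ?_
    simp [inner_oneW_derivW]
  refine ⟨F, ⟨hF0, ?_⟩, hf, hF⟩
  set P := (ℝ ∙ p.oneV)ᗮ.starProjection with hP
  -- The mean zero part of a classical function is the primitive of its derivative.
  have hPn : ∀ n, P (classV (h.1 n)) = p.primitive (derivW (h.1 n)) := by
    intro n
    rw [classV_eq, map_add, map_smul, hP, starProjection_orthogonal_self, smul_zero, add_zero,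
      primitive_apply p (inner_oneW_derivW _)]
  have hPf : P f = p.primitive F := by
    refine tendsto_nhds_unique ((P.continuous.tendsto f).comp hf) ?_
    refine ((p.primitive.continuous.tendsto F).comp hF).congr fun n => ?_
    simp [hPn]
  obtain ⟨c, hc⟩ := exists_starProjection_orthogonal_eq p.oneV f
  exact ⟨c, by rw [← hPf, hP, hc, sub_add_cancel]⟩

variable (p) in
/-- The classes in `L²_V(𝕋)` of periodic càdlàg functions. -/
def cadlagClasses : Submodule ℝ p.L2V where
  carrier := {u | ∃ φ, IsCadlag φ ∧ Function.Periodic φ 1 ∧ u =ᵐ[p.μV] φ}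
  add_mem' := by
    rintro u v ⟨φ, h1, h2, h3⟩ ⟨ψ, h4, h5, h6⟩
    refine ⟨fun x => φ x - (0 - ψ x), h1.sub ((isCadlag_const 0).sub h4),
      fun x => by simp only [h2 x, h5 x], ?_⟩
    filter_upwards [h3, h6, Lp.coeFn_add u v] with x h7 h8 h9
    rw [h9, Pi.add_apply, h7, h8]
    ring
  zero_mem' := ⟨fun _ => 0, isCadlag_const 0, fun _ => rfl, Lp.coeFn_zero _ _ _⟩
  smul_mem' := by
    rintro c u ⟨φ, h1, h2, h3⟩
    refine ⟨fun x => c * φ x, fun x => ?_, fun x => by simp only [h2 x], ?_⟩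
    · obtain ⟨h4, l, h5⟩ := h1 x
      exact ⟨h4.const_mul c, c * l, h5.const_mul c⟩
    · filter_upwards [h3, Lp.coeFn_smul c u] with x h4 h5
      rw [h5, Pi.smul_apply, h4, smul_eq_mul]

theorem oneV_mem_cadlagClasses : p.oneV ∈ p.cadlagClasses :=
  ⟨fun _ => 1, isCadlag_const 1, fun _ => rfl, p.coeFn_oneV⟩

theorem volterra_mem_cadlagClasses (F : p.L2W) : volterra p.μW p.μV F ∈ p.cadlagClasses := by
  refine ⟨fun x => ∫ s in Iic (Int.fract x), F s ∂p.μW,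
    (isCadlag_setIntegral_Iic (integrable_of_Lp_two F)).comp_fract, fun x => ?_, ?_⟩
  · simp only [Int.fract_add_one]
  · filter_upwards [coeFn_volterra p.μW p.μV F, p.ae_mem_Ico_μV] with x h1 h2
    rw [h1, Int.fract_eq_self.2 h2]

theorem starProjection_mem_cadlagClasses {u : p.L2V} (hu : u ∈ p.cadlagClasses) :
    (ℝ ∙ p.oneV)ᗮ.starProjection u ∈ p.cadlagClasses := by
  obtain ⟨c, hc⟩ := exists_starProjection_orthogonal_eq p.oneV u
  rw [hc]
  exact sub_mem hu (Submodule.smul_mem _ _ oneV_mem_cadlagClasses)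

/-- The derivatives of classical functions are dense in the mean zero functions: for `K`
orthogonal to all of them, test with the primitive of `K`, which is itself càdlàg. -/
theorem mem_closure_adjoint_cadlagClasses {F : p.L2W} (hF : inner ℝ p.oneW F = 0) :
    F ∈ closure (p.primitive.adjoint '' (p.cadlagClasses : Set p.L2V)) := by
  have h : (p.cadlagClasses.map (p.primitive.adjoint : p.L2V →ₗ[ℝ] p.L2W))ᗮ ≤ ℝ ∙ p.oneW := by
    intro K hK
    have hmem : p.primitive K ∈ p.cadlagClasses :=
      starProjection_mem_cadlagClasses (volterra_mem_cadlagClasses _)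
    have h1 := (Submodule.mem_orthogonal _ _).1 hK _ (Submodule.mem_map_of_mem hmem)
    have h2 : inner ℝ (p.primitive K) (p.primitive K) = 0 := by
      rw [← ContinuousLinearMap.adjoint_inner_left]
      exact h1
    obtain ⟨c, hc⟩ := p.exists_smul_eq_of_primitive_eq_zero K (inner_self_eq_zero.1 h2)
    rw [hc]
    exact Submodule.smul_mem _ _ (Submodule.mem_span_singleton_self _)
  have h1 := Submodule.orthogonal_le h
    (Submodule.mem_orthogonal_singleton_iff_inner_right.2 hF)
  rw [Submodule.orthogonal_orthogonal_eq_closure] at h1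
  have h2 : F ∈ closure
      ((p.cadlagClasses.map (p.primitive.adjoint : p.L2V →ₗ[ℝ] p.L2W) : Submodule ℝ p.L2W) :
        Set p.L2W) := h1
  simpa using h2

/-- `J† u` is the derivative of a classical function when `u` has a periodic càdlàg representative:
solve `D⁺_V D⁻_W f = -u` after removing the mean of `u`, which `J†` does not see. -/
theorem exists_strongDomain_derivW_eq {u : p.L2V} (hu : u ∈ p.cadlagClasses) (c : ℝ) :
    ∃ f, ∃ hf : f ∈ p.strongDomain, f 0 = c ∧ derivW hf = p.primitive.adjoint u := by
  set v := -(ℝ ∙ p.oneV)ᗮ.starProjection u with hv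
  have hvmem : v ∈ p.cadlagClasses := neg_mem (starProjection_mem_cadlagClasses hu)
  obtain ⟨φ, h1, h2, h3⟩ := hvmem
  have h4 : ∫ s, φ s ∂p.μV = 0 := by
    rw [← integral_congr_ae h3, ← inner_oneV, hv, inner_neg_right,
      inner_starProjection_orthogonal, neg_zero]
  obtain ⟨f, hf, hf0, hff⟩ := exists_strongDomain h1 h2 h4 c
  refine ⟨f, hf, hf0, ?_⟩
  have h5 : deriv₂V hf = v := by
    refine Lp.ext ?_
    filter_upwards [coeFn_deriv₂V hf, h3] with x h6 h7
    rw [h6, h7, hff]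
  obtain ⟨d, hd⟩ := exists_starProjection_orthogonal_eq p.oneV u
  rw [derivW_eq, h5, hv, map_neg, neg_neg, hd, map_sub, map_smul, adjoint_primitive_oneV,
    smul_zero, sub_zero]

/-- Functions with a weak derivative are limits of classical functions: approximate the derivative
and keep the value at the origin. -/
theorem exists_admissible {f : p.L2V} {F : p.L2W} (h : p.IsSobolevDeriv f F) :
    ∃ fn, p.Admissible fn f := by
  obtain ⟨hF, c, hc⟩ := isSobolevDeriv_iff_volterra.1 h
  obtain ⟨Fn, hFn, hlim⟩ := mem_closure_iff_seq_limit.1 (mem_closure_adjoint_cadlagClasses hF)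
  choose un hun hFun using hFn
  choose fn hfn hfn0 hd using fun n => exists_strongDomain_derivW_eq (hun n) c
  have hDlim : Tendsto (fun n => derivW (hfn n)) atTop (𝓝 F) :=
    hlim.congr fun n => by rw [hd, hFun]
  have hflim : Tendsto (fun n => classV (hfn n)) atTop (𝓝 f) := by
    rw [hc]
    refine (((volterra p.μW p.μV).continuous.tendsto F).comp hDlim |>.add_const _).congr
      fun n => ?_
    rw [classV_eq, hfn0]
    rfl
  refine ⟨fn, hfn, (tendsto_classV_iff hfn).1 hflim, fun ε hε => ?_⟩
  obtain ⟨N, hN⟩ := Metric.cauchySeq_iff.1 hflim.cauchySeq (ε / 2) (half_pos hε)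
  obtain ⟨M, hM⟩ := Metric.cauchySeq_iff.1 hDlim.cauchySeq (ε / 2) (half_pos hε)
  refine ⟨max N M, fun m hm n hn => ?_⟩
  have h1 := hN m ((le_max_left _ _).trans hm) n ((le_max_left _ _).trans hn)
  have h2 := hM m ((le_max_right _ _).trans hm) n ((le_max_right _ _).trans hn)
  rw [dist_eq_norm] at h1 h2
  rw [energyNorm_sub (hfn m) (hfn n), Real.sqrt_lt' hε]
  nlinarith [norm_nonneg (classV (hfn m) - classV (hfn n)),
    norm_nonneg (derivW (hfn m) - derivW (hfn n))]

theorem mem_sobolev_iff {f : p.L2V} :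
    f ∈ p.sobolev ↔ ∃ F, IsWeakDeriv p.primitive p.oneW p.oneV f F := by
  constructor
  · rintro ⟨fn, hfn⟩
    obtain ⟨F, hF, -⟩ := hfn.exists_isWeakDeriv
    exact ⟨F, hF⟩
  · rintro ⟨F, hF⟩
    exact exists_admissible (isSobolevDeriv_iff.2 hF)

/-- The eigenvalue equation in weak form: along admissible sequences the energy form converges to
`⟨u, v⟩ + ⟨D u, D v⟩`. -/
theorem isLaplacian_iff {u : p.L2V} {l : ℝ} :
    p.IsLaplacian u (-(l • u)) ↔ IsWeakEigen p.primitive p.oneW p.oneV u l := by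
  have hlim : ∀ {v un vn} {F G : p.L2W}, IsWeakDeriv p.primitive p.oneW p.oneV u F →
      IsWeakDeriv p.primitive p.oneW p.oneV v G → p.Admissible un u → p.Admissible vn v →
      Tendsto (fun n => p.energyForm (un n) (vn n)) atTop (𝓝 (inner ℝ u v + inner ℝ F G)) := by
    intro v un vn F G hF hG hun hvn
    obtain ⟨F', hF', hu1, hu2⟩ := hun.exists_isWeakDeriv
    obtain ⟨G', hG', hv1, hv2⟩ := hvn.exists_isWeakDeriv
    have e1 : F = F' := (isSobolevDeriv_iff.2 hF).unique (isSobolevDeriv_iff.2 hF')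
    have e2 : G = G' := (isSobolevDeriv_iff.2 hG).unique (isSobolevDeriv_iff.2 hG')
    rw [e1, e2]
    refine ((hu1.inner hv1).add (hu2.inner hv2)).congr fun n => ?_
    rw [energyForm_eq (hun.1 n) (hvn.1 n)]
  have hval : ∀ v, inner ℝ (u - -(l • u)) v = inner ℝ u v + l * inner ℝ u v := by
    intro v
    rw [sub_neg_eq_add, inner_add_left, real_inner_smul_left]
  rw [IsLaplacian, IsFriedrichs, IsWeakEigen, mem_sobolev_iff]
  refine and_congr_right fun _ => ⟨fun h F v G hF hG => ?_, fun h v hv un vn hun hvn => ?_⟩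
  · obtain ⟨un, hun⟩ := exists_admissible (isSobolevDeriv_iff.2 hF)
    obtain ⟨vn, hvn⟩ := exists_admissible (isSobolevDeriv_iff.2 hG)
    have h1 := tendsto_nhds_unique (h v ⟨vn, hvn⟩ un vn hun hvn) (hlim hF hG hun hvn)
    rw [hval] at h1
    linarith
  · obtain ⟨F, hF, -⟩ := hun.exists_isWeakDeriv
    obtain ⟨G, hG, -⟩ := hvn.exists_isWeakDeriv
    rw [hval, ← h F v G hF hG]
    exact hlim hF hG hun hvn

theorem derivSpace_eq : p.derivSpace = ((ℝ ∙ p.oneW)ᗮ : Submodule ℝ p.L2W) := by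
  ext F
  rw [SetLike.mem_coe, Submodule.mem_orthogonal_singleton_iff_inner_right]
  constructor
  · rintro ⟨f, -, hf⟩
    exact (isSobolevDeriv_iff.1 hf).1
  · intro hF
    have h : IsWeakDeriv p.primitive p.oneW p.oneV (p.primitive F) F := ⟨hF, 0, by simp⟩
    exact ⟨_, mem_sobolev_iff.2 ⟨F, h⟩, isSobolevDeriv_iff.2 h⟩

end WeightPair

end

theorem theorem5p2 (p : WeightPair) :
    (∃ (ν : ℕ → p.L2V) (lam : ℕ → ℝ), p.IsEigensystem ν lam) ∧
    ∀ (ν : ℕ → p.L2V) (lam : ℕ → ℝ), p.IsEigensystem ν lam →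
      p.sobolev = {f : p.L2V | ∃ α : ℕ → ℝ,
        HasSum (fun i => α (i + 1) • ν (i + 1)) (f - Lp.const 2 p.μV (α 0)) ∧
        Summable (fun i => lam (i + 1) * α (i + 1) ^ 2)} ∧
      (∀ i, 0 < lam (i + 1)) ∧
      Orthonormal ℝ (fun i => (√(lam (i + 1)))⁻¹ • p.sobolevDeriv (ν (i + 1))) ∧
      ((Submodule.span ℝ (range fun i =>
        (√(lam (i + 1)))⁻¹ • p.sobolevDeriv (ν (i + 1)))).topologicalClosure : Set p.L2W) =
          p.derivSpace := by
  have hJ := p.exists_smul_eq_of_primitive_eq_zero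
  have hb := p.adjoint_primitive_oneV
  constructor
  · have : Fact ((2 : ENNReal) ≠ ⊤) := ⟨ENNReal.ofNat_ne_top⟩
    obtain ⟨ν, lam, h1, h2, h3, h4⟩ := exists_weakEigen_basis p.not_finiteDimensional_L2V
      p.isCompactOperator_primitive p.oneV_ne_zero p.primitive_oneW hJ hb
      p.exists_smul_eq_of_adjoint_primitive_eq_zero
    exact ⟨ν, lam, h1, h2, fun i => WeightPair.isLaplacian_iff.2 (h3 i), h4⟩
  · rintro ν lam ⟨hν, hd, heig, h0⟩
    have heig' := fun i => WeightPair.isLaplacian_iff.1 (heig i)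
    have hF : ∀ i, IsWeakDeriv p.primitive p.oneW p.oneV (ν i) (p.sobolevDeriv (ν i)) := by
      intro i
      obtain ⟨F, hF⟩ := (heig' i).1
      rwa [(WeightPair.isSobolevDeriv_iff.2 hF).sobolevDeriv_eq]
    refine ⟨?_, weakEigenvalue_pos hν hF heig' h0, orthonormal_normalized_deriv hν hF heig' h0, ?_⟩
    · ext f
      rw [WeightPair.mem_sobolev_iff, exists_isWeakDeriv_iff hb hν hd hF heig' h0]
      simp only [WeightPair.const_eq_smul_oneV, mem_ofPred_eq]
    · rw [closure_span_normalized_deriv hJ hb hν hd hF heig' h0, WeightPair.derivSpace_eq]
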